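/- **Setting.** Consider a multistage stochastic program with $S$ scenarios $\xi^s=(\xi^s_1,\dots,\xi^s_{T-1})$, of probabilities $p_s>0$ with $\sum_s p_s=1$, and $T$ stages, with decisions $x^s=(x^s_1,\dots,x^s_T)\in\mathbb R^{n_1}\times\dots\times\mathbb R^{n_T}=\mathbb R^n$. Let $\mathcal B^s_t$ be the set of the scenarios $\sigma$ with $(\xi^\sigma_1,\dots,\xi^\sigma_{t-1})=(\xi^s_1,\dots,\xi^s_{t-1})$ and let $\mathcal W=\{x\in\mathbb R^{S\times n}: x^s_t=x^\sigma_t \text{ for all } t,\ s,\ \sigma\in\mathcal B^s_t\}$ be the non-anticipativity subspace. The problem is $$\min_{x\in\mathcal W}\ \sum_{s=1}^S p_s f^s(x^s).\qquad (1)$$ Assume that every $f^s:\mathbb R^n\to(-\infty,+\infty]$ is convex, proper and lower semicontinuous, that (1) has a solution, and that $\mathcal W$ meets the relative interior of the domain of the objective function. For $z\in\mathbb R^{S\times n}$ let $\Pi z\in\mathcal W$ be the bundle average, $(\Pi z)^s_t=\big(\sum_{\sigma\in\mathcal B^s_t}p_\sigma\big)^{-1}\sum_{\sigma\in\mathcal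 B^s_t}p_\sigma z^\sigma_t$. **Algorithm (Asynchronous Randomized Progressive Hedging).** Let $\mu>0$, let $q=(q_s)$ be a probability vector, $q_{\min}=\min_s q_s$, and $z^0=x^0\in\mathcal W$ deterministic. A master works with $M$ workers. Initially each worker $j$ holds some given scenario $s[j]$ (for instance $s[j]=j$), and $\bar x[j]=v[j]=x^{0,s[j]}$. At update $k=0,1,\dots$ some worker $i$ returns $y=\operatorname{argmin}_{u\in\mathbb R^n}\{f^{s[i]}(u)+\frac1{2\mu}\|u-v[i]\|^2\}$, and the master sets $$z^{k+1,s[i]}=z^{k,s[i]}+\frac{2\eta^k}{S\,q_{s[i]}}\,(y-\bar x[i]),\qquad z^{k+1,s}=z^{k,s}\ \ (s\ne s[i]).$$ It then draws a new scenario $s[i]$ for this worker, with probabilities $(q_s)$, and sets $\bar x[i]=(\Pi z^{k+1})^{s[i]}$ and $v[i]=2\bar x[i]-z^{k+1,s[i]}$. The output is $\tilde x^k=\Pi z^k$. The delay $d^k$ is defined by the fact that the result incorporated at update $k$ was computed from $z^{k-d^k}$. The order in which the workers return may be random. A drawn scenario is independent of the past at the time of its incorporation: if it is incorporated at update $k$,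 it has law $q$ conditionally on the workers that returned at updates $0,\dots,k$ and on the scenarios incorporated at updates $0,\dots,k-1$. (This holds in particular if the draws are i.i.d. with law $q$ and independent of the order in which the workers return.) **Theorem.** Suppose that, for a deterministic $\tau\in\mathbb N$, almost surely $d^k\le\tau$ for all $k$, and that the deterministic stepsizes satisfy, for some $\eta_{\min}$ and some $0<c<1$, $$0<\eta_{\min}\le\eta^k\le\frac{c\,S\,q_{\min}}{2\tau\sqrt{q_{\min}}+1}\qquad\text{for all }k.$$ Then almost surely $\tilde x^k\in\mathcal W$ for all $k$, and $(\tilde x^k)$ converges almost surely to a random variable that takes its values almost surely in the solution set of (1). -/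

import Mathlib

open MeasureTheory Filter Topology

namespace ProgHedging

noncomputable section

/-- The decision space of one scenario, `ℝ^{n_1} × ⋯ × ℝ^{n_T} = ℝ^n` with its Euclidean norm.
The coordinate `⟨t, i⟩` is the `i`-th coordinate of the decision at stage `t`. Stages are numbered
from `0`. -/
abbrev Row {T : ℕ} (n : Fin T → ℕ) : Type := EuclideanSpace ℝ (Σ t : Fin T, Fin (n t))

/-- The space `ℝ^{S × n}`: one decision row for each of the `S` scenarios. -/
abbrev Decision (S : ℕ) {T : ℕ} (n : Fin T → ℕ) : Type := Fin S → Row n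

/-- The data of a multistage stochastic program with `S` scenarios and `T` stages. Scenario `s` is
the realization `(ξ s 0, …, ξ s (T - 2))` of the uncertainty, it has probability `p s`, and its cost
function `f s` takes values in the extended reals (constraints are part of the cost). -/
structure Problem (S T : ℕ) (n : Fin T → ℕ) (Ξ : Fin (T - 1) → Type*) where
  /-- The scenarios. -/
  ξ : Fin S → (r : Fin (T - 1)) → Ξ r
  /-- The scenario probabilities. -/
  p : Fin S → ℝ
  /-- The scenario costs. -/
  f : Fin S → Row n → EReal

/-- Convexity of an extended-real-valued function: its epigraph is convex. -/
def ConvexFun {E : Type*} [AddCommGroup E] [Module ℝ E] (g : E → EReal) : Prop :=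
  Convex ℝ {a : E × ℝ | g a.1 ≤ (a.2 : EReal)}

/-- A proper function: it never takes the value `-∞` and is not identically `+∞`. -/
def ProperFun {E : Type*} (g : E → EReal) : Prop :=
  (∀ x, g x ≠ ⊥) ∧ ∃ x, g x ≠ ⊤

/-- `argmin_y { g y + ‖y - v‖² / (2 μ) }`. (For `g` convex, proper, lower semicontinuous and `μ > 0`
there is exactly one minimizer.) -/
def proxArgmin {E : Type*} [NormedAddCommGroup E] (g : E → EReal) (μ : ℝ) (v : E) : E :=
  Classical.epsilon fun y : E =>
    ∀ y' : E, g y + ((1 / (2 * μ) * ‖y - v‖ ^ 2 : ℝ) : EReal)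
      ≤ g y' + ((1 / (2 * μ) * ‖y' - v‖ ^ 2 : ℝ) : EReal)

namespace Problem

variable {S T : ℕ} {n : Fin T → ℕ} {Ξ : Fin (T - 1) → Type*} (D : Problem S T n Ξ)

/-- The scenarios `s` and `s'` are indistinguishable at stage `t`: the uncertainty revealed before
the decision of stage `t` is the same. (For the first stage, `t = 0`, this is always true.) -/
def Indist (t : Fin T) (s s' : Fin S) : Prop :=
  ∀ r : Fin (T - 1), (r : ℕ) < (t : ℕ) → D.ξ s r = D.ξ s' r

/-- The non-anticipativity subspace `𝒲` of `ℝ^{S × n}`. -/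
def nonant : Submodule ℝ (Decision S n) where
  carrier := {x | ∀ (s s' : Fin S) (t : Fin T), D.Indist t s s' →
    ∀ i : Fin (n t), x s ⟨t, i⟩ = x s' ⟨t, i⟩}
  add_mem' := by
    intro a b ha hb s s' t h i
    simp [ha s s' t h i, hb s s' t h i]
  zero_mem' := by
    intro s s' t _ i
    simp
  smul_mem' := by
    intro c a ha s s' t h i
    simp [ha s s' t h i]

/-- The objective function `∑ s, p_s f^s(x^s)`. -/
def objective (x : Decision S n) : EReal :=
  ∑ s, (D.p s : EReal) * D.f s (x s)

/-- The domain of the objective function. -/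
def dom : Set (Decision S n) := {x | D.objective x < ⊤}

/-- The set of solutions of `min_{x ∈ 𝒲} ∑ s, p_s f^s(x^s)`. -/
def solutions : Set (Decision S n) :=
  {x | x ∈ D.nonant ∧ ∀ y ∈ D.nonant, D.objective x ≤ D.objective y}

/-- The blanket assumptions: the scenario probabilities are positive (and sum to one); the costs are
convex, proper and lower semicontinuous; a solution exists; `𝒲` meets the relative interior of the
domain of the objective function. -/
structure Assumptions : Prop where
  p_pos : ∀ s, 0 < D.p s
  p_sum : ∑ s, D.p s = 1
  convex : ∀ s, ConvexFun (D.f s)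
  proper : ∀ s, ProperFun (D.f s)
  lsc : ∀ s, LowerSemicontinuous (D.f s)
  exists_solution : D.solutions.Nonempty
  qualification : ((D.nonant : Set (Decision S n)) ∩ intrinsicInterior ℝ D.dom).Nonempty

open Classical in
/-- The bundle of the scenarios that are indistinguishable from `s` at stage `t`. -/
def bundle (t : Fin T) (s : Fin S) : Finset (Fin S) :=
  Finset.univ.filter fun σ => D.Indist t s σ

/-- The average over bundles, weighted by the scenario probabilities:
`(proj z)_t^s = (∑_{σ ∈ B_t^s} p_σ)⁻¹ ∑_{σ ∈ B_t^s} p_σ z_t^σ`. -/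
def proj (z : Decision S n) : Decision S n := fun s =>
  WithLp.toLp 2 fun a : (Σ t : Fin T, Fin (n t)) =>
    (∑ σ ∈ D.bundle a.1 s, D.p σ)⁻¹ * ∑ σ ∈ D.bundle a.1 s, D.p σ * z σ a

end Problem

/-- The state of the asynchronous algorithm with `M` workers, just before an update of the master:
the master variable `z`, and for each worker `j` the scenario `scen j` it is treating, the point
`old j` that was averaged when `j` was last fed, the proximal centre `sent j` that was sent to `j`,
and the index `start j` of the master variable that was read when `j` was last fed. -/
structure State (S M : ℕ) {T : ℕ} (n : Fin T → ℕ) where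
  z : Decision S n
  scen : Fin M → Fin S
  old : Fin M → Row n
  sent : Fin M → Row n
  start : Fin M → ℕ

namespace Problem

variable {S T M : ℕ} {n : Fin T → ℕ} {Ξ : Fin (T - 1) → Type*} (D : Problem S T n Ξ)

/-- Initialization at `z⁰ = x⁰`: worker `j` is fed with the pair `(s₀ j, x⁰ (s₀ j))`. -/
def init (x₀ : Decision S n) (s₀ : Fin M → Fin S) : State S M n where
  z := x₀
  scen := s₀
  old := fun j => x₀ (s₀ j)
  sent := fun j => x₀ (s₀ j)
  start := fun _ => 0

/-- The update of the master variable `z` in update number `k`, when worker `i` returns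
`y = argmin { f^{s[i]}(y) + ‖y - sent[i]‖² / (2 μ) }`:
`z^{s[i]} ← z^{s[i]} + 2 η^k / (S q_{s[i]}) (y - old[i])`, the other rows being unchanged. -/
def updateZ (q : Fin S → ℝ) (μ : ℝ) (ηk : ℝ) (i : Fin M) (σ : State S M n) : Decision S n :=
  Function.update σ.z (σ.scen i)
    (σ.z (σ.scen i) + (2 * ηk / (S * q (σ.scen i))) •
      (proxArgmin (D.f (σ.scen i)) μ (σ.sent i) - σ.old i))

/-- Update number `k` of the master, with stepsize `ηk`: worker `i` returns its result, the master
variable becomes `z^{k+1}`, and worker `i` is fed anew with the scenario `s`, using `z^{k+1}`. -/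
def step (q : Fin S → ℝ) (μ : ℝ) (k : ℕ) (ηk : ℝ) (i : Fin M) (s : Fin S)
    (σ : State S M n) : State S M n :=
  let z' := D.updateZ q μ ηk i σ
  { z := z'
    scen := Function.update σ.scen i s
    old := Function.update σ.old i (D.proj z' s)
    sent := Function.update σ.sent i ((2 : ℝ) • D.proj z' s - z' s)
    start := Function.update σ.start i (k + 1) }

/-- The run of the algorithm: `w k` is the worker that returns at update `k`, and `draw k` is the
new scenario drawn for it. `D.run … k` is the state just before update `k`. -/
def run (x₀ : Decision S n) (s₀ : Fin M → Fin S) (q : Fin S → ℝ) (μ : ℝ) (η : ℕ → ℝ)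
    (w : ℕ → Fin M) (draw : ℕ → Fin S) : ℕ → State S M n
  | 0 => init x₀ s₀
  | k + 1 => D.step q μ k (η k) (w k) (draw k) (run x₀ s₀ q μ η w draw k)

/-- The output `x̃^k`: the average of `z^k` over all bundles. -/
def output (x₀ : Decision S n) (s₀ : Fin M → Fin S) (q : Fin S → ℝ) (μ : ℝ) (η : ℕ → ℝ)
    (w : ℕ → Fin M) (draw : ℕ → Fin S) (k : ℕ) : Decision S n :=
  D.proj (D.run x₀ s₀ q μ η w draw k).z

/-- The scenario incorporated by the master at update `k`, i.e. the one that the worker `w k`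
was treating. -/
def usedScen (x₀ : Decision S n) (s₀ : Fin M → Fin S) (q : Fin S → ℝ) (μ : ℝ) (η : ℕ → ℝ)
    (w : ℕ → Fin M) (draw : ℕ → Fin S) (k : ℕ) : Fin S :=
  (D.run x₀ s₀ q μ η w draw k).scen (w k)

/-- The delay `d^k`: the result incorporated at update `k` was computed from `z^{k - d^k}`.
(There is no truncation in the subtraction: the index read is at most `k`.) -/
def delay (x₀ : Decision S n) (s₀ : Fin M → Fin S) (q : Fin S → ℝ) (μ : ℝ) (η : ℕ → ℝ)
    (w : ℕ → Fin M) (draw : ℕ → Fin S) (k : ℕ) : ℕ :=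
  k - (D.run x₀ s₀ q μ η w draw k).start (w k)

end Problem

/-- The scenarios are sampled with probabilities `q`, independently of the past: `w k` is the worker
that returns at update `k` and `used k` the scenario it was treating. Unless this scenario is the
initial one of that worker (which is not drawn), it has the law `q` conditionally on the workers
`w 0, …, w k` that have returned so far and on the scenarios `used 0, …, used (k - 1)` incorporated
before. This is the case in particular if the draws are i.i.d. with law `q` and independent of the
order in which the workers return. -/
def SampledFrom {Ω : Type*} [MeasurableSpace Ω] (P : Measure Ω) {S M : ℕ} (q : Fin S → ℝ)
    (w : ℕ → Ω → Fin M) (used : ℕ → Ω → Fin S) : Prop :=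
  ∀ (k : ℕ) (s : Fin S) (a : ℕ → Fin M) (b : ℕ → Fin S), (∃ j < k, a j = a k) →
    P.real {ω | (∀ j ≤ k, w j ω = a j) ∧ (∀ j < k, used j ω = b j) ∧ used k ω = s}
      = q s * P.real {ω | (∀ j ≤ k, w j ω = a j) ∧ (∀ j < k, used j ω = b j)}

end

end ProgHedging

/-!
Separation under the qualification condition gives every solution a multiplier `u ⟂ 𝒲`, so the
solutions are the points `Π z` for `z` a fixed point of the Douglas-Rachford reflection
`R = (2 prox - 1) ∘ (2 Π - 1)`, which is nonexpansive for the inner product weighted by the `p_s`.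
An update of the master moves one randomly drawn block of `z` along the residual `z - R z` read at a
delayed iterate. For a fixed point `v`, the squared distance to `v` plus a weighted sum of the last
`τ` squared displacements then decreases in conditional expectation by a multiple of the squared
residual: the displacements pay for the error due to the delay. Supermartingale convergence and
Opial's argument, run over a countable dense set of fixed points, give almost sure convergence to a
random fixed point.
-/

namespace ProgHedging

section Prox

open scoped RealInnerProductSpace

variable {E : Type*} [NormedAddCommGroup E] {g : E → EReal} {μ : ℝ}

/-- `y` is a proximal point of `v`, that is, one of the minimizers among which `proxArgmin`
chooses. -/
def IsProx (g : E → EReal) (μ : ℝ) (v y : E) : Prop :=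
  ∀ y', g y + ((1 / (2 * μ) * ‖y - v‖ ^ 2 : ℝ) : EReal)
    ≤ g y' + ((1 / (2 * μ) * ‖y' - v‖ ^ 2 : ℝ) : EReal)

theorem IsProx.ne_top {v y : E} (hp : ProperFun g) (hy : IsProx g μ v y) : g y ≠ ⊤ := by
  obtain ⟨hbot, x, hx⟩ := hp
  intro h
  have hle := hy x
  rw [h, EReal.top_add_coe, top_le_iff, ← EReal.coe_toReal hx (hbot x), ← EReal.coe_add] at hle
  exact EReal.coe_ne_top _ hle

variable [InnerProductSpace ℝ E]

/-- The class `Γ₀(E)` of convex analysis, on which the proximal operator is well defined. -/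
structure ProperConvexLsc (g : E → EReal) : Prop where
  convex : ConvexFun g
  proper : ProperFun g
  lsc : LowerSemicontinuous g

/-- `u` is a subgradient of `g` at `x`; the value `g x` is required to be finite. -/
def HasSubgradientAt (g : E → EReal) (u x : E) : Prop :=
  ∃ r : ℝ, g x = r ∧ ∀ y, ((r + ⟪u, y - x⟫ : ℝ) : EReal) ≤ g y

/-- The reflection `2 prox - 1` through the proximal operator of `g`. -/
noncomputable def proxReflection (g : E → EReal) (μ : ℝ) (v : E) : E :=
  (2 : ℝ) • proxArgmin g μ v - v

theorem HasSubgradientAt.monotone {x y u v : E} (hu : HasSubgradientAt g u x)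
    (hv : HasSubgradientAt g v y) : 0 ≤ ⟪u - v, x - y⟫ := by
  obtain ⟨r, hr, hux⟩ := hu
  obtain ⟨r', hr', hvy⟩ := hv
  have hxy : r + ⟪u, y - x⟫ ≤ r' := EReal.coe_le_coe_iff.1 (hr' ▸ hux y)
  have hyx : r' + ⟪v, x - y⟫ ≤ r := EReal.coe_le_coe_iff.1 (hr ▸ hvy x)
  rw [← neg_sub x y, inner_neg_right] at hxy
  rw [inner_sub_left]
  linarith

theorem ProperConvexLsc.exists_affine_le [CompleteSpace E] (hg : ProperConvexLsc g) :
    ∃ (u : E) (a : ℝ), ∀ y, ((⟪u, y⟫ + a : ℝ) : EReal) ≤ g y := by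
  obtain ⟨hbot, x, hx⟩ := hg.proper
  obtain ⟨r, hr⟩ : ∃ r : ℝ, g x = r := ⟨_, (EReal.coe_toReal hx (hbot x)).symm⟩
  have hclosed : IsClosed {a : E × ℝ | g a.1 ≤ (a.2 : EReal)} :=
    hg.lsc.isClosed_epigraph.preimage
      (continuous_fst.prodMk (continuous_coe_real_ereal.comp continuous_snd))
  have hbelow : (x, r - 1) ∉ {a : E × ℝ | g a.1 ≤ (a.2 : EReal)} := by
    rw [Set.mem_ofPred_eq, hr, EReal.coe_le_coe_iff]
    simp
  obtain ⟨ℓ, b, hlt, hgt⟩ := geometric_hahn_banach_point_closed hg.convex hclosed hbelow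
  have hℓ : ∀ y t, ℓ (y, t) = ℓ (y, 0) + t * ℓ (0, 1) := fun y t => by
    rw [← smul_eq_mul, ← map_smul, ← map_add]; simp
  have hslope : 0 < ℓ (0, 1) := by
    have habove := hgt (x, r) hr.le
    rw [hℓ] at hlt habove
    linarith
  let m : StrongDual ℝ E := ℓ.comp (ContinuousLinearMap.inl ℝ E ℝ)
  refine ⟨-(ℓ (0, 1))⁻¹ • (InnerProductSpace.toDual ℝ E).symm m, (ℓ (0, 1))⁻¹ * b, fun y => ?_⟩
  cases h : g y with
  | bot => exact absurd h (hbot y)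
  | top => exact le_top
  | coe t =>
    have habove := hgt (y, t) h.le
    have hm : m y = ℓ (y, 0) := rfl
    rw [hℓ] at habove
    rw [EReal.coe_le_coe_iff, real_inner_smul_left, InnerProductSpace.toDual_symm_apply, hm,
      neg_mul, neg_add_eq_sub, ← mul_sub, inv_mul_le_iff₀ hslope]
    linarith

theorem exists_forall_le_of_forall_notMem {X : Type*} [TopologicalSpace X] {φ : X → EReal}
    (hφ : LowerSemicontinuous φ) {K : Set X} (hK : IsCompact K) {x : X} (hx : x ∈ K)
    (hle : ∀ y ∉ K, φ x ≤ φ y) : ∃ y, ∀ y', φ y ≤ φ y' := by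
  obtain ⟨y, -, hy⟩ := (hφ.lowerSemicontinuousOn K).exists_isMinOn ⟨x, hx⟩ hK
  refine ⟨y, fun y' => ?_⟩
  by_cases hy' : y' ∈ K
  · exact hy hy'
  · exact (hy hx).trans (hle y' hy')

theorem inner_add_sq_norm_sub_eq (hμ : 0 < μ) (u v y : E) :
    ⟪u, y⟫ + 1 / (2 * μ) * ‖y - v‖ ^ 2
      = 1 / (2 * μ) * ‖y - (v - μ • u)‖ ^ 2 + (⟪u, v⟫ - μ / 2 * ‖u‖ ^ 2) := by
  have e : y - (v - μ • u) = (y - v) + μ • u := by abel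
  rw [e, norm_add_sq_real, inner_smul_right, norm_smul, Real.norm_eq_abs, abs_of_pos hμ,
    inner_sub_left, real_inner_comm u y, real_inner_comm u v]
  field_simp
  ring

theorem ProperConvexLsc.exists_isProx [FiniteDimensional ℝ E] (hg : ProperConvexLsc g)
    (hμ : 0 < μ) (v : E) : ∃ y, IsProx g μ v y := by
  obtain ⟨hbot, x, hx⟩ := hg.proper
  obtain ⟨r, hr⟩ : ∃ r : ℝ, g x = r := ⟨_, (EReal.coe_toReal hx (hbot x)).symm⟩
  obtain ⟨u, a, hua⟩ := hg.exists_affine_le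
  set m : E → ℝ := fun y => ⟪u, y⟫ + 1 / (2 * μ) * ‖y - v‖ ^ 2 with hm
  have hminorant : ∀ y, ((m y + a : ℝ) : EReal)
      ≤ g y + ((1 / (2 * μ) * ‖y - v‖ ^ 2 : ℝ) : EReal) := fun y => by
    rw [hm, add_right_comm, EReal.coe_add]
    gcongr
    exact hua y
  have hlsc : LowerSemicontinuous fun y => g y + ((1 / (2 * μ) * ‖y - v‖ ^ 2 : ℝ) : EReal) :=
    hg.lsc.add' (continuous_coe_real_ereal.comp (by fun_prop)).lowerSemicontinuous fun y =>
      EReal.continuousAt_add (Or.inr (EReal.coe_ne_bot _)) (Or.inl (hbot y))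
  set A : ℝ := r + 1 / (2 * μ) * ‖x - v‖ ^ 2
  have hA : g x + ((1 / (2 * μ) * ‖x - v‖ ^ 2 : ℝ) : EReal) = (A : EReal) := by
    rw [hr, ← EReal.coe_add]
  have hcompact : IsCompact {y | m y + a ≤ A} := by
    refine (isCompact_closedBall (v - μ • u)
      √(2 * μ * (A - a - (⟪u, v⟫ - μ / 2 * ‖u‖ ^ 2)))).of_isClosed_subset
      (isClosed_le (by fun_prop) continuous_const) fun y (hy : m y + a ≤ A) => ?_
    simp only [hm, inner_add_sq_norm_sub_eq hμ] at hy
    rw [mem_closedBall_iff_norm]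
    refine Real.le_sqrt_of_sq_le ?_
    rw [← inv_mul_le_iff₀ (by positivity), ← one_div]
    linarith
  refine exists_forall_le_of_forall_notMem hlsc hcompact (x := x)
    (EReal.coe_le_coe_iff.1 ((hminorant x).trans hA.le)) fun y hy => ?_
  exact hA.le.trans ((EReal.coe_le_coe_iff.2 (not_le.1 hy).le).trans (hminorant y))

theorem ProperConvexLsc.isProx_proxArgmin [FiniteDimensional ℝ E] (hg : ProperConvexLsc g)
    (hμ : 0 < μ) (v : E) : IsProx g μ v (proxArgmin g μ v) :=
  Classical.epsilon_spec (hg.exists_isProx hμ v)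

theorem nonneg_of_forall_nonneg_add_mul {a b : ℝ} (h : ∀ t ∈ Set.Ioc (0 : ℝ) 1, 0 ≤ a + t * b) :
    0 ≤ a := by
  have hlim : Tendsto (fun t : ℝ => a + t * b) (𝓝[>] 0) (𝓝 (a + 0 * b)) :=
    (Continuous.tendsto (by fun_prop) 0).mono_left nhdsWithin_le_nhds
  rw [zero_mul, add_zero] at hlim
  exact ge_of_tendsto hlim (eventually_of_mem (Ioc_mem_nhdsGT one_pos) h)

/- The minimality of `y` is tested at the point `(1 - t) y + t y'` of the segment, and the resulting
inequality is divided by `t`. -/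
theorem IsProx.nonneg_secant (hc : ConvexFun g) (hμ : 0 < μ) {v y y' : E} (hy : IsProx g μ v y)
    {r r' : ℝ} (hr : g y = r) (hr' : g y' = r') {t : ℝ} (ht : t ∈ Set.Ioc (0 : ℝ) 1) :
    0 ≤ (r' - r + 1 / μ * ⟪y - v, y' - y⟫) + t * (1 / (2 * μ) * ‖y' - y‖ ^ 2) := by
  have hconv : g ((1 - t) • y + t • y') ≤ (((1 - t) * r + t * r' : ℝ) : EReal) :=
    hc (x := (y, r)) hr.le (y := (y', r')) hr'.le (sub_nonneg.2 ht.2) ht.1.le (by ring)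
  have hmin := (hy ((1 - t) • y + t • y')).trans (add_le_add_left hconv _)
  have e : (1 - t) • y + t • y' - v = (y - v) + t • (y' - y) := by
    simp only [sub_smul, smul_sub, one_smul]; abel
  rw [hr, ← EReal.coe_add, ← EReal.coe_add, EReal.coe_le_coe_iff, e, norm_add_sq_real,
    inner_smul_right, norm_smul, Real.norm_eq_abs, abs_of_pos ht.1] at hmin
  refine nonneg_of_mul_nonneg_right (a := t) ?_ ht.1
  have hμ2 : 1 / μ = 2 * (1 / (2 * μ)) := by field_simp
  rw [hμ2]
  linarith

theorem IsProx.hasSubgradientAt (hc : ConvexFun g) (hp : ProperFun g) (hμ : 0 < μ) {v y : E}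
    (hy : IsProx g μ v y) : HasSubgradientAt g ((1 / μ) • (v - y)) y := by
  have hr : g y = ((g y).toReal : EReal) := (EReal.coe_toReal (hy.ne_top hp) (hp.1 y)).symm
  refine ⟨(g y).toReal, hr, fun y' => ?_⟩
  cases hr' : g y' with
  | bot => exact absurd hr' (hp.1 y')
  | top => exact le_top
  | coe r' =>
    have hlim := nonneg_of_forall_nonneg_add_mul fun t ht => hy.nonneg_secant hc hμ hr hr' ht
    rw [EReal.coe_le_coe_iff, real_inner_smul_left, ← neg_sub y v, inner_neg_left]
    linarith

theorem ProperConvexLsc.hasSubgradientAt_proxArgmin [FiniteDimensional ℝ E]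
    (hg : ProperConvexLsc g) (hμ : 0 < μ) (v : E) :
    HasSubgradientAt g ((1 / μ) • (v - proxArgmin g μ v)) (proxArgmin g μ v) :=
  (hg.isProx_proxArgmin hμ v).hasSubgradientAt hg.convex hg.proper hμ

theorem ProperConvexLsc.proxArgmin_add_smul [FiniteDimensional ℝ E] (hg : ProperConvexLsc g)
    (hμ : 0 < μ) {x u : E} (hu : HasSubgradientAt g u x) : proxArgmin g μ (x + μ • u) = x := by
  have hmono := (hg.hasSubgradientAt_proxArgmin hμ (x + μ • u)).monotone hu
  set y := proxArgmin g μ (x + μ • u)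
  have e : (1 / μ) • (x + μ • u - y) - u = -((1 / μ) • (y - x)) := by
    rw [add_sub_right_comm, smul_add, smul_smul, one_div_mul_cancel hμ.ne', one_smul,
      add_sub_cancel_right, ← smul_neg, neg_sub]
  rw [e, inner_neg_left, real_inner_smul_left, Left.nonneg_neg_iff] at hmono
  have hinner : ⟪y - x, y - x⟫ ≤ 0 := nonpos_of_mul_nonpos_right hmono (by positivity)
  exact sub_eq_zero.1 (real_inner_self_nonpos.1 hinner)

theorem ProperConvexLsc.lipschitzWith_proxReflection [FiniteDimensional ℝ E]
    (hg : ProperConvexLsc g) (hμ : 0 < μ) : LipschitzWith 1 (proxReflection g μ) := by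
  refine LipschitzWith.of_dist_le_mul fun v w => ?_
  rw [NNReal.coe_one, one_mul, dist_eq_norm, dist_eq_norm]
  refine le_of_sq_le_sq ?_ (norm_nonneg _)
  have hmono := (hg.hasSubgradientAt_proxArgmin hμ v).monotone
    (hg.hasSubgradientAt_proxArgmin hμ w)
  simp only [proxReflection]
  set a := proxArgmin g μ v
  set b := proxArgmin g μ w
  have e : (2 : ℝ) • a - v - ((2 : ℝ) • b - w) = (2 : ℝ) • (a - b) - (v - w) := by
    rw [smul_sub]; abel
  rw [← smul_sub, real_inner_smul_left, sub_sub_sub_comm v a w b, inner_sub_left,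
    real_inner_self_eq_norm_sq, real_inner_comm] at hmono
  have hfirm := nonneg_of_mul_nonneg_right hmono (by positivity)
  rw [e, norm_sub_sq_real, norm_smul, real_inner_smul_left, Real.norm_ofNat]
  linarith

end Prox

section Multiplier

variable {E : Type*} [AddCommGroup E] [Module ℝ E]

theorem eq_zero_or_mem_convexConeHull_of_mem_hull {s : Set E} {x : E}
    (hx : x ∈ PointedCone.hull ℝ s) : x = 0 ∨ x ∈ ConvexCone.hull ℝ s := by
  induction hx using Submodule.span_induction with
  | mem x hx => exact Or.inr (ConvexCone.subset_hull hx)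
  | zero => exact Or.inl rfl
  | add x y _ _ hx hy =>
    rcases hx with rfl | hx
    · rwa [zero_add]
    rcases hy with rfl | hy
    · rw [add_zero]; exact Or.inr hx
    · exact Or.inr ((ConvexCone.hull ℝ s).add_mem hx hy)
  | smul c x _ hx =>
    rcases hx with rfl | hx
    · exact Or.inl (smul_zero c)
    rcases c.2.eq_or_lt with hc | hc
    · obtain rfl : c = 0 := Subtype.ext hc.symm
      exact Or.inl (zero_smul _ x)
    · exact Or.inr ((ConvexCone.hull ℝ s).smul_mem hc hx)

variable [TopologicalSpace E] [IsTopologicalAddGroup E] [ContinuousSMul ℝ E]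

theorem exists_pos_add_smul_mem_of_mem_intrinsicInterior {C : Set E} {x d : E}
    (hx : x ∈ intrinsicInterior ℝ C) (hd : d ∈ vectorSpan ℝ C) : ∃ ε > (0 : ℝ), x + ε • d ∈ C := by
  obtain ⟨y, hy, rfl⟩ := mem_intrinsicInterior.1 hx
  have hmem : ∀ t : ℝ, (y : E) + t • d ∈ affineSpan ℝ C := fun t => by
    rw [add_comm]
    exact AffineSubspace.vadd_mem_of_mem_direction
      (direction_affineSpan ℝ C ▸ Submodule.smul_mem _ t hd) y.2
  have hcont : Continuous fun t : ℝ => (⟨(y : E) + t • d, hmem t⟩ : affineSpan ℝ C) :=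
    Continuous.subtype_mk (by fun_prop) _
  have hzero : (⟨(y : E) + (0 : ℝ) • d, hmem 0⟩ : affineSpan ℝ C) = y := by ext; simp
  have hnear : ∀ᶠ t : ℝ in 𝓝[>] 0, (y : E) + t • d ∈ C :=
    ((hcont.tendsto 0).eventually
      (hzero.symm ▸ mem_interior_iff_mem_nhds.1 hy)).filter_mono nhdsWithin_le_nhds
  obtain ⟨ε, hεC, hε⟩ := (hnear.and self_mem_nhdsWithin).exists
  exact ⟨ε, hε, hεC⟩

theorem exists_add_mem_hull_epigraph {C : Set E} {φ : E → ℝ} {W V' : Submodule ℝ E}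
    (hV' : (W ⊔ vectorSpan ℝ C) ⊔ V' = ⊤) {x : E} (hxW : x ∈ W) (hx : x ∈ intrinsicInterior ℝ C)
    (b : E × ℝ) : ∃ a : E × ℝ, a.1 ∈ W ⊔ V' ∧
      a + b ∈ PointedCone.hull ℝ {a : E × ℝ | a.1 ∈ C ∧ φ a.1 ≤ a.2} := by
  obtain ⟨b, ρ⟩ := b
  obtain ⟨v, hv, v', hv', rfl⟩ := Submodule.mem_sup.1 (hV' ▸ Submodule.mem_top (x := b))
  obtain ⟨w, hw, d, hd, rfl⟩ := Submodule.mem_sup.1 hv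
  obtain ⟨ε, hε, hεC⟩ := exists_pos_add_smul_mem_of_mem_intrinsicInterior hx hd
  refine ⟨((ε⁻¹ • x - w) + -v', ε⁻¹ * φ (x + ε • d) - ρ),
    Submodule.add_mem_sup (sub_mem (Submodule.smul_mem _ _ hxW) hw) (neg_mem hv'), ?_⟩
  have e : ((ε⁻¹ • x - w) + -v', ε⁻¹ * φ (x + ε • d) - ρ) + (w + d + v', ρ)
      = ε⁻¹ • (x + ε • d, φ (x + ε • d)) := by
    ext
    · simp only [Prod.mk_add_mk, Prod.smul_mk, smul_add, inv_smul_smul₀ hε.ne']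
      abel
    · simp
  rw [e]
  exact PointedCone.smul_mem _ (inv_nonneg.2 hε.le) (PointedCone.subset_hull ⟨hεC, le_rfl⟩)

/- The multiplier is minus the extension, nonnegative on the cone generated by the epigraph of
`φ - m`, of the functional `(x, t) ↦ t` on `(W ⊔ V') × ℝ`, where `V'` is a complement of the span of
`W` and `C`. -/
theorem exists_linearMap_le_of_forall_mem_le {C : Set E} {φ : E → ℝ} (hφ : ConvexOn ℝ C φ)
    {W : Submodule ℝ E} {m : ℝ} (hmin : ∀ y ∈ C, y ∈ W → m ≤ φ y) {x : E} (hxW : x ∈ W)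
    (hx : x ∈ intrinsicInterior ℝ C) :
    ∃ ℓ : E →ₗ[ℝ] ℝ, (∀ w ∈ W, ℓ w = 0) ∧ ∀ y ∈ C, m + ℓ y ≤ φ y := by
  obtain ⟨V', hV'⟩ := Submodule.exists_isCompl (W ⊔ vectorSpan ℝ C)
  set K := {a : E × ℝ | a.1 ∈ C ∧ φ a.1 - m ≤ a.2}
  have hK : Convex ℝ K := (hφ.sub (concaveOn_const m hφ.1)).convex_epigraph
  let f : (E × ℝ) →ₗ.[ℝ] ℝ :=
    { domain := (W ⊔ V').prod ⊤
      toFun := (LinearMap.snd ℝ E ℝ).comp (Submodule.subtype _) }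
  have hnonneg : ∀ a : f.domain, (a : E × ℝ) ∈ PointedCone.hull ℝ K → 0 ≤ f a := by
    rintro ⟨a, haW, -⟩ (ha : a ∈ PointedCone.hull ℝ K)
    change 0 ≤ a.2
    rcases eq_zero_or_mem_convexConeHull_of_mem_hull ha with rfl | ha
    · exact le_rfl
    obtain ⟨l, hl, ⟨y, t⟩, ⟨hyC, hyt⟩, rfl⟩ := (ConvexCone.mem_hull_of_convex hK).1 ha
    have hyV : y ∈ W ⊔ vectorSpan ℝ C := by
      have hyx := vsub_mem_vectorSpan ℝ hyC (intrinsicInterior_subset hx)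
      simpa using Submodule.add_mem_sup hxW hyx
    have hW : (W ⊔ V') ⊓ (W ⊔ vectorSpan ℝ C) = W := by
      rw [sup_inf_assoc_of_le V' le_sup_left, hV'.symm.inf_eq_bot, sup_bot_eq]
    have hyW : y ∈ W := hW ▸ ⟨(Submodule.smul_mem_iff _ hl.ne').1 haW, hyV⟩
    exact mul_nonneg hl.le ((sub_nonneg.2 (hmin y hyC hyW)).trans hyt)
  have hdense : ∀ b, ∃ a : f.domain, (a : E × ℝ) + b ∈ PointedCone.hull ℝ K := fun b =>
    let ⟨a, ha, hab⟩ := exists_add_mem_hull_epigraph (φ := fun y => φ y - m) hV'.sup_eq_top hxW hx b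
    ⟨⟨a, ha, trivial⟩, hab⟩
  obtain ⟨g, hgf, hgK⟩ := riesz_extension _ f hnonneg hdense
  refine ⟨-(g.comp (LinearMap.inl ℝ E ℝ)), fun w hw => ?_, fun y hy => ?_⟩
  · have hgw : g (w, 0) = 0 := hgf ⟨(w, 0), Submodule.mem_sup_left hw, trivial⟩
    simpa using hgw
  · have hsnd : g (0, φ y - m) = φ y - m := hgf ⟨(0, φ y - m), zero_mem _, trivial⟩
    have hpos : 0 ≤ g (y, φ y - m) := hgK _ (PointedCone.subset_hull ⟨hy, le_rfl⟩)
    have hadd : g (y, φ y - m) = g (y, 0) + g (0, φ y - m) := by rw [← map_add]; simp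
    rw [hadd, hsnd] at hpos
    simp only [LinearMap.neg_apply, LinearMap.comp_apply, LinearMap.inl_apply]
    linarith

end Multiplier

theorem sum_apply_update {ι E : Type*} [Fintype ι] [DecidableEq ι]
    (F : ι → E → ℝ) (x : ι → E) (i : ι) (v : E) :
    ∑ j, F j (Function.update x i v j) = ∑ j, F j (x j) + (F i v - F i (x i)) := by
  simp only [Function.apply_update F, Finset.sum_update_of_mem (Finset.mem_univ i),
    Finset.sum_eq_add_sum_sdiff_singleton_of_mem (Finset.mem_univ i) fun j => F j (x j)]
  ring

open scoped RealInnerProductSpace in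
theorem exists_eq_sum_mul_inner {ι E : Type*} [Fintype ι] [NormedAddCommGroup E]
    [InnerProductSpace ℝ E] [FiniteDimensional ℝ E] {p : ι → ℝ}
    (hp : ∀ i, p i ≠ 0) (ℓ : (ι → E) →ₗ[ℝ] ℝ) :
    ∃ u : ι → E, ∀ x, ℓ x = ∑ i, p i * ⟪u i, x i⟫ := by
  classical
  refine ⟨fun i => (p i)⁻¹ • (InnerProductSpace.toDual ℝ E).symm
    (LinearMap.toContinuousLinearMap (ℓ.comp (LinearMap.single ℝ (fun _ => E) i))), fun x => ?_⟩
  simp only [real_inner_smul_left, InnerProductSpace.toDual_symm_apply, mul_inv_cancel_left₀ (hp _)]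
  conv_lhs => rw [← Finset.univ_sum_single x, map_sum]
  rfl

namespace Problem

open scoped RealInnerProductSpace

variable {S T : ℕ} {n : Fin T → ℕ} {Ξ : Fin (T - 1) → Type*} {D : Problem S T n Ξ}

theorem Assumptions.properConvexLsc (hD : D.Assumptions) (s : Fin S) : ProperConvexLsc (D.f s) :=
  ⟨hD.convex s, hD.proper s, hD.lsc s⟩

theorem objective_eq_coe {x : Decision S n} {r : Fin S → ℝ} (h : ∀ s, D.f s (x s) = r s) :
    D.objective x = ((∑ s, D.p s * r s : ℝ) : EReal) := by
  let coe : ℝ →+ EReal := ⟨⟨fun r => (r : EReal), EReal.coe_zero⟩, EReal.coe_add⟩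
  rw [objective, show ((∑ s, D.p s * r s : ℝ) : EReal) = ∑ s, ((D.p s * r s : ℝ) : EReal) from
    map_sum coe _ _]
  exact Finset.sum_congr rfl fun s _ => by rw [h, EReal.coe_mul]

theorem Assumptions.coe_toReal_of_ne_top (hD : D.Assumptions) {s : Fin S} {y : Row n}
    (hy : D.f s y ≠ ⊤) : ((D.f s y).toReal : EReal) = D.f s y :=
  EReal.coe_toReal hy ((hD.proper s).1 y)

theorem Assumptions.mul_ne_bot (hD : D.Assumptions) (s : Fin S) (y : Row n) :
    (D.p s : EReal) * D.f s y ≠ ⊥ := by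
  by_cases h : D.f s y = ⊤
  · rw [h, EReal.coe_mul_top_of_pos (hD.p_pos s)]
    exact top_ne_bot
  · rw [← hD.coe_toReal_of_ne_top h, ← EReal.coe_mul]
    exact EReal.coe_ne_bot _

theorem Assumptions.mem_dom_iff (hD : D.Assumptions) {x : Decision S n} :
    x ∈ D.dom ↔ ∀ s, D.f s (x s) ≠ ⊤ := by
  refine ⟨fun hx s hs => (ne_of_lt hx : D.objective x ≠ ⊤) ?_, fun h => ?_⟩
  · have hrest : ∑ s' ∈ Finset.univ.erase s, (D.p s' : EReal) * D.f s' (x s') ≠ ⊥ :=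
      Finset.sum_induction _ (· ≠ ⊥)
        (fun a b ha hb => by simp only [ne_eq, EReal.add_eq_bot_iff, ha, hb, or_self,
          not_false_eq_true])
        EReal.zero_ne_bot fun s' _ => hD.mul_ne_bot s' (x s')
    rw [objective, ← Finset.add_sum_erase _ _ (Finset.mem_univ s), hs,
      EReal.coe_mul_top_of_pos (hD.p_pos s), EReal.top_add_of_ne_bot hrest]
  · change D.objective x < ⊤
    rw [objective_eq_coe fun s => (hD.coe_toReal_of_ne_top (h s)).symm]
    exact EReal.coe_lt_top _

theorem Assumptions.objective_eq (hD : D.Assumptions) {x : Decision S n} (hx : x ∈ D.dom) :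
    D.objective x = ((∑ s, D.p s * (D.f s (x s)).toReal : ℝ) : EReal) :=
  objective_eq_coe fun s => (hD.coe_toReal_of_ne_top (hD.mem_dom_iff.1 hx s)).symm

theorem Assumptions.convexOn_dom (hD : D.Assumptions) :
    ConvexOn ℝ D.dom fun x => ∑ s, D.p s * (D.f s (x s)).toReal := by
  have hle : ∀ ⦃x⦄, x ∈ D.dom → ∀ ⦃y⦄, y ∈ D.dom → ∀ ⦃a b : ℝ⦄, 0 ≤ a → 0 ≤ b → a + b = 1 → ∀ s,
      D.f s ((a • x + b • y) s)
        ≤ ((a * (D.f s (x s)).toReal + b * (D.f s (y s)).toReal : ℝ) : EReal) :=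
    fun x hx y hy a b ha hb hab s =>
      hD.convex s (x := (x s, (D.f s (x s)).toReal))
        (hD.coe_toReal_of_ne_top (hD.mem_dom_iff.1 hx s)).ge
        (y := (y s, (D.f s (y s)).toReal))
        (hD.coe_toReal_of_ne_top (hD.mem_dom_iff.1 hy s)).ge ha hb hab
  refine ⟨fun x hx y hy a b ha hb hab => hD.mem_dom_iff.2 fun s =>
    ne_top_of_le_ne_top (EReal.coe_ne_top _) (hle hx hy ha hb hab s),
    fun x hx y hy a b ha hb hab => ?_⟩
  simp only [smul_eq_mul, Finset.mul_sum, ← Finset.sum_add_distrib]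
  refine Finset.sum_le_sum fun s _ => ?_
  have hreal := EReal.toReal_le_toReal (hle hx hy ha hb hab s) ((hD.proper s).1 _)
    (EReal.coe_ne_top _)
  rw [EReal.toReal_coe] at hreal
  linarith [mul_le_mul_of_nonneg_left hreal (hD.p_pos s).le]

variable (D) in
/-- The Karush-Kuhn-Tucker conditions for the problem: `u` consists of subgradients of the scenario
costs at the non-anticipative point `x` and is orthogonal to `𝒲` for the inner product weighted by
the scenario probabilities. -/
structure IsKKTPair (x u : Decision S n) : Prop where
  mem_nonant : x ∈ D.nonant
  hasSubgradientAt : ∀ s, HasSubgradientAt (D.f s) (u s) (x s)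
  sum_inner_eq_zero : ∀ w ∈ D.nonant, ∑ s, D.p s * ⟪u s, w s⟫ = 0

theorem IsKKTPair.mem_solutions (hD : D.Assumptions) {x u : Decision S n} (h : D.IsKKTPair x u) :
    x ∈ D.solutions := by
  refine ⟨h.mem_nonant, fun y hy => ?_⟩
  by_cases hyd : y ∈ D.dom
  · choose r hr hle using h.hasSubgradientAt
    rw [objective_eq_coe hr, hD.objective_eq hyd, EReal.coe_le_coe_iff]
    have hsub : ∀ s, r s + ⟪u s, (y - x) s⟫ ≤ (D.f s (y s)).toReal := fun s => by
      rw [← EReal.coe_le_coe_iff, hD.coe_toReal_of_ne_top (hD.mem_dom_iff.1 hyd s)]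
      exact hle s (y s)
    calc ∑ s, D.p s * r s
        = ∑ s, D.p s * (r s + ⟪u s, (y - x) s⟫) := by
          simp only [mul_add, Finset.sum_add_distrib,
            h.sum_inner_eq_zero _ (sub_mem hy h.mem_nonant), add_zero]
      _ ≤ _ := Finset.sum_le_sum fun s _ => mul_le_mul_of_nonneg_left (hsub s) (hD.p_pos s).le
  · exact le_of_le_of_eq le_top (not_lt_top_iff.1 hyd).symm

theorem Assumptions.exists_isKKTPair (hD : D.Assumptions) :
    ∃ x u : Decision S n, D.IsKKTPair x u := by
  obtain ⟨x, hxW, hmin⟩ := hD.exists_solution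
  obtain ⟨x₀, hx₀W, hx₀⟩ := hD.qualification
  have hx : x ∈ D.dom := lt_of_le_of_lt (hmin x₀ hx₀W) (intrinsicInterior_subset hx₀ : x₀ ∈ D.dom)
  have hmin' : ∀ y ∈ D.dom, y ∈ D.nonant →
      ∑ s, D.p s * (D.f s (x s)).toReal ≤ ∑ s, D.p s * (D.f s (y s)).toReal := fun y hy hyW => by
    rw [← EReal.coe_le_coe_iff, ← hD.objective_eq hx, ← hD.objective_eq hy]
    exact hmin y hyW
  obtain ⟨ℓ, hℓW, hℓ⟩ := exists_linearMap_le_of_forall_mem_le hD.convexOn_dom hmin' hx₀W hx₀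
  obtain ⟨u, hu⟩ := exists_eq_sum_mul_inner (fun s => (hD.p_pos s).ne') ℓ
  refine ⟨x, u, hxW, fun s => ⟨(D.f s (x s)).toReal,
    (hD.coe_toReal_of_ne_top (hD.mem_dom_iff.1 hx s)).symm, fun y => ?_⟩, fun w hw => ?_⟩
  · by_cases hy : D.f s y = ⊤
    · exact hy ▸ le_top
    rw [← hD.coe_toReal_of_ne_top hy, EReal.coe_le_coe_iff]
    have hupd : Function.update x s y ∈ D.dom := hD.mem_dom_iff.2 fun s' => by
      rcases eq_or_ne s' s with rfl | h
      · rwa [Function.update_self]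
      · rw [Function.update_of_ne h]
        exact hD.mem_dom_iff.1 hx s'
    have hle := hℓ _ hupd
    rw [hu, sum_apply_update fun s' v => D.p s' * ⟪u s', v⟫, ← hu, hℓW x hxW,
      sum_apply_update fun s' v => D.p s' * (D.f s' v).toReal, ← mul_sub, ← inner_sub_right] at hle
    refine le_of_mul_le_mul_left ?_ (hD.p_pos s)
    linarith
  · rw [← hu, hℓW w hw]

end Problem

section Weighting

open scoped RealInnerProductSpace

variable {ι E : Type*} [NormedAddCommGroup E]

/-- The isomorphism `x ↦ (√(p i) x i)` that turns the inner product `∑ i, p i ⟪x i, y i⟫` into the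
standard one of the Hilbert sum. -/
noncomputable def weighting [NormedSpace ℝ E] (p : ι → ℝ) (hp : ∀ i, 0 < p i) :
    (ι → E) ≃L[ℝ] PiLp 2 (fun _ : ι => E) :=
  (ContinuousLinearEquiv.piCongrRight fun i =>
    ContinuousLinearEquiv.smulLeft (Units.mk0 √(p i) (Real.sqrt_pos.2 (hp i)).ne')).trans
    (PiLp.continuousLinearEquiv 2 ℝ fun _ : ι => E).symm

variable {p : ι → ℝ} {hp : ∀ i, 0 < p i}

theorem weighting_apply [NormedSpace ℝ E] (x : ι → E) (i : ι) :
    weighting p hp x i = √(p i) • x i :=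
  rfl

variable [Fintype ι] [InnerProductSpace ℝ E]

theorem inner_weighting (x y : ι → E) :
    ⟪weighting p hp x, weighting p hp y⟫ = ∑ i, p i * ⟪x i, y i⟫ := by
  rw [PiLp.inner_apply]
  refine Finset.sum_congr rfl fun i _ => ?_
  rw [weighting_apply, weighting_apply, real_inner_smul_left, real_inner_smul_right, ← mul_assoc,
    Real.mul_self_sqrt (hp i).le]

theorem norm_weighting_sq (x : ι → E) : ‖weighting p hp x‖ ^ 2 = ∑ i, p i * ‖x i‖ ^ 2 := by
  simp only [← real_inner_self_eq_norm_sq, inner_weighting]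

end Weighting

namespace Problem

open scoped RealInnerProductSpace

variable {S T : ℕ} {n : Fin T → ℕ} {Ξ : Fin (T - 1) → Type*} {D : Problem S T n Ξ}

theorem mem_bundle {t : Fin T} {s σ : Fin S} : σ ∈ D.bundle t s ↔ D.Indist t s σ := by
  simp [bundle]

theorem Indist.symm {t : Fin T} {s σ : Fin S} (h : D.Indist t s σ) : D.Indist t σ s :=
  fun r hr => (h r hr).symm

theorem Indist.bundle_eq {t : Fin T} {s σ : Fin S} (h : D.Indist t s σ) :
    D.bundle t s = D.bundle t σ := by
  ext a
  simp only [mem_bundle]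
  exact ⟨fun h' r hr => (h r hr).symm.trans (h' r hr), fun h' r hr => (h r hr).trans (h' r hr)⟩

theorem proj_apply (z : Decision S n) (s : Fin S) (a : Σ t : Fin T, Fin (n t)) :
    D.proj z s a = (∑ σ ∈ D.bundle a.1 s, D.p σ)⁻¹ * ∑ σ ∈ D.bundle a.1 s, D.p σ * z σ a :=
  rfl

theorem proj_mem (z : Decision S n) : D.proj z ∈ D.nonant := by
  intro s s' t h i
  rw [proj_apply, proj_apply, h.bundle_eq]

theorem proj_sub (x y : Decision S n) : D.proj (x - y) = D.proj x - D.proj y := by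
  ext s a
  simp only [proj_apply, Pi.sub_apply, PiLp.sub_apply, mul_sub, Finset.sum_sub_distrib]

theorem continuous_proj : Continuous D.proj :=
  continuous_pi fun _ => (PiLp.continuous_toLp 2 _).comp (continuous_pi fun _ => by fun_prop)

theorem Assumptions.sum_mul_average_mul (hD : D.Assumptions) (t : Fin T) (g h : Fin S → ℝ)
    (hh : ∀ s σ, D.Indist t s σ → h s = h σ) :
    ∑ s, D.p s * (((∑ σ ∈ D.bundle t s, D.p σ)⁻¹ * ∑ σ ∈ D.bundle t s, D.p σ * g σ) * h s)
      = ∑ s, D.p s * (g s * h s) := by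
  set B : Fin S → ℝ := fun s => ∑ σ ∈ D.bundle t s, D.p σ with hB
  have hpos : ∀ s, 0 < B s := fun s =>
    Finset.sum_pos (fun σ _ => hD.p_pos σ) ⟨s, mem_bundle.2 fun _ _ => rfl⟩
  calc ∑ s, D.p s * (((B s)⁻¹ * ∑ σ ∈ D.bundle t s, D.p σ * g σ) * h s)
      = ∑ s, ∑ σ ∈ D.bundle t s, D.p s * ((B s)⁻¹ * (D.p σ * g σ) * h s) := by
        simp only [Finset.mul_sum, Finset.sum_mul]
    _ = ∑ σ, ∑ s ∈ D.bundle t σ, D.p s * ((B s)⁻¹ * (D.p σ * g σ) * h s) := by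
        refine Finset.sum_comm' fun s σ => ?_
        simp only [Finset.mem_univ, true_and, and_true, mem_bundle]
        exact ⟨Indist.symm, Indist.symm⟩
    _ = ∑ σ, ∑ s ∈ D.bundle t σ, D.p s * ((B σ)⁻¹ * (D.p σ * g σ) * h σ) := by
        refine Finset.sum_congr rfl fun σ _ => Finset.sum_congr rfl fun s hs => ?_
        rw [hh σ s (mem_bundle.1 hs)]
        simp only [hB, (mem_bundle.1 hs).bundle_eq]
    _ = ∑ σ, B σ * ((B σ)⁻¹ * (D.p σ * g σ) * h σ) := by
        simp only [← Finset.sum_mul, hB]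
    _ = ∑ s, D.p s * (g s * h s) := Finset.sum_congr rfl fun σ _ => by
        rw [mul_assoc, mul_inv_cancel_left₀ (hpos σ).ne', mul_assoc]

theorem Assumptions.inner_weighting_proj (hD : D.Assumptions) (z : Decision S n)
    {x : Decision S n} (hx : x ∈ D.nonant) :
    ⟪weighting D.p hD.p_pos (D.proj z), weighting D.p hD.p_pos x⟫
      = ⟪weighting D.p hD.p_pos z, weighting D.p hD.p_pos x⟫ := by
  have hcoord : ∀ y : Decision S n, ⟪weighting D.p hD.p_pos y, weighting D.p hD.p_pos x⟫
      = ∑ a, ∑ s, D.p s * (y s a * x s a) := fun y => by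
    rw [inner_weighting]
    simp only [PiLp.inner_apply, Finset.mul_sum]
    rw [Finset.sum_comm]
    exact Finset.sum_congr rfl fun a _ => Finset.sum_congr rfl fun s _ => by
      rw [real_inner_comm]; rfl
  rw [hcoord, hcoord]
  exact Finset.sum_congr rfl fun a _ =>
    hD.sum_mul_average_mul a.1 (fun s => z s a) (fun s => x s a) fun s σ h => hx s σ a.1 h a.2

theorem Assumptions.proj_eq (hD : D.Assumptions) {x z : Decision S n} (hx : x ∈ D.nonant)
    (horth : ∀ w ∈ D.nonant, ∑ s, D.p s * ⟪(z - x) s, w s⟫ = 0) : D.proj z = x := by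
  set ψ : Decision S n ≃L[ℝ] _ := weighting D.p hD.p_pos
  have hmem : D.proj z - x ∈ D.nonant := sub_mem (D.proj_mem z) hx
  have hzero : ∀ w ∈ D.nonant, ⟪ψ (D.proj z - x), ψ w⟫ = 0 := fun w hw =>
    calc ⟪ψ (D.proj z - x), ψ w⟫ = ⟪ψ (z - x), ψ w⟫ := by
          rw [map_sub, map_sub, inner_sub_left, inner_sub_left, hD.inner_weighting_proj z hw]
      _ = 0 := (inner_weighting _ _).trans (horth w hw)
  exact sub_eq_zero.1 (ψ.map_eq_zero_iff.1 (inner_self_eq_zero.1 (hzero _ hmem)))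

theorem Assumptions.proj_eq_self (hD : D.Assumptions) {x : Decision S n} (hx : x ∈ D.nonant) :
    D.proj x = x :=
  hD.proj_eq hx fun w _ => by simp

theorem Assumptions.norm_weighting_two_smul_proj_sub (hD : D.Assumptions) (z : Decision S n) :
    ‖weighting D.p hD.p_pos ((2 : ℝ) • D.proj z - z)‖ = ‖weighting D.p hD.p_pos z‖ := by
  have horth := hD.inner_weighting_proj z (D.proj_mem z)
  rw [real_inner_self_eq_norm_sq, real_inner_comm] at horth
  refine (sq_eq_sq₀ (norm_nonneg _) (norm_nonneg _)).1 ?_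
  rw [map_sub, map_smul, norm_sub_sq_real, norm_smul, real_inner_smul_left, Real.norm_ofNat,
    mul_pow, horth]
  ring

variable (D) in
/-- The composition of the two reflections of the Douglas-Rachford splitting: through `𝒲`, then
through the proximal operators of the scenario costs. -/
noncomputable def drReflection (μ : ℝ) (z : Decision S n) : Decision S n := fun s =>
  proxReflection (D.f s) μ ((2 : ℝ) • D.proj z s - z s)

/-- The Douglas-Rachford reflection, transported by `weighting` to the Hilbert space where it is
nonexpansive. -/
noncomputable def Assumptions.drOperator (hD : D.Assumptions) (μ : ℝ) :
    PiLp 2 (fun _ : Fin S => Row n) → PiLp 2 (fun _ : Fin S => Row n) := fun z =>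
  weighting D.p hD.p_pos (D.drReflection μ ((weighting D.p hD.p_pos).symm z))

theorem Assumptions.drOperator_weighting (hD : D.Assumptions) (μ : ℝ) (z : Decision S n) :
    hD.drOperator μ (weighting D.p hD.p_pos z)
      = weighting D.p hD.p_pos (D.drReflection μ z) := by
  rw [drOperator, ContinuousLinearEquiv.symm_apply_apply]

theorem Assumptions.lipschitzWith_drOperator (hD : D.Assumptions) {μ : ℝ} (hμ : 0 < μ) :
    LipschitzWith 1 (hD.drOperator μ) := by
  refine LipschitzWith.of_dist_le_mul fun x' y' => ?_
  obtain ⟨x, rfl⟩ := (weighting D.p hD.p_pos).surjective x'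
  obtain ⟨y, rfl⟩ := (weighting D.p hD.p_pos).surjective y'
  rw [NNReal.coe_one, one_mul, dist_eq_norm, dist_eq_norm, hD.drOperator_weighting,
    hD.drOperator_weighting, ← map_sub, ← map_sub, ← hD.norm_weighting_two_smul_proj_sub (x - y)]
  refine le_of_sq_le_sq ?_ (norm_nonneg _)
  rw [norm_weighting_sq, norm_weighting_sq]
  refine Finset.sum_le_sum fun s _ => mul_le_mul_of_nonneg_left ?_ (hD.p_pos s).le
  have hprox := ((hD.properConvexLsc s).lipschitzWith_proxReflection hμ).dist_le_mul
    ((2 : ℝ) • D.proj x s - x s) ((2 : ℝ) • D.proj y s - y s)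
  rw [NNReal.coe_one, one_mul, dist_eq_norm, dist_eq_norm] at hprox
  have e : ((2 : ℝ) • D.proj (x - y) - (x - y)) s
      = (2 : ℝ) • D.proj x s - x s - ((2 : ℝ) • D.proj y s - y s) := by
    rw [proj_sub, smul_sub, sub_sub_sub_comm]; rfl
  rw [e]
  gcongr
  exact hprox

theorem IsKKTPair.drReflection_eq (hD : D.Assumptions) {μ : ℝ} (hμ : 0 < μ) {x u : Decision S n}
    (h : D.IsKKTPair x u) : D.drReflection μ (x - μ • u) = x - μ • u := by
  have hproj : D.proj (x - μ • u) = x := hD.proj_eq h.mem_nonant fun w hw => by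
    simp only [sub_sub_cancel_left, Pi.neg_apply, Pi.smul_apply, inner_neg_left,
      real_inner_smul_left, mul_neg, mul_left_comm _ μ, Finset.sum_neg_distrib, ← Finset.mul_sum,
      h.sum_inner_eq_zero w hw, mul_zero, neg_zero]
  ext1 s
  have hcentre : (2 : ℝ) • x s - (x - μ • u) s = x s + μ • u s := by
    simp only [Pi.sub_apply, Pi.smul_apply, two_smul]; abel
  rw [drReflection, hproj, hcentre, proxReflection,
    (hD.properConvexLsc s).proxArgmin_add_smul hμ (h.hasSubgradientAt s), ← hcentre, sub_sub_cancel]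

theorem isKKTPair_of_drReflection_eq (hD : D.Assumptions) {μ : ℝ} (hμ : 0 < μ)
    {z : Decision S n} (hz : D.drReflection μ z = z) :
    D.IsKKTPair (D.proj z) ((1 / μ) • (D.proj z - z)) := by
  refine ⟨D.proj_mem z, fun s => ?_, fun w hw => ?_⟩
  · have hfix : (2 : ℝ) • proxArgmin (D.f s) μ ((2 : ℝ) • D.proj z s - z s)
        = (2 : ℝ) • D.proj z s := by
      rw [sub_eq_iff_eq_add.1 (congrFun hz s)]
      abel
    have hprox := smul_right_injective _ (two_ne_zero' ℝ) hfix
    have hsub := (hD.properConvexLsc s).hasSubgradientAt_proxArgmin hμ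
      ((2 : ℝ) • D.proj z s - z s)
    rw [hprox] at hsub
    convert hsub using 2
    rw [Pi.smul_apply, Pi.sub_apply, two_smul]
    congr 1
    abel
  · have horth := hD.inner_weighting_proj z hw
    rw [inner_weighting, inner_weighting] at horth
    simp only [Pi.smul_apply, Pi.sub_apply, real_inner_smul_left, inner_sub_left, mul_sub,
      mul_left_comm _ (1 / μ), ← Finset.mul_sum, Finset.sum_sub_distrib, horth, sub_self]

end Problem

section CoordStep

open scoped RealInnerProductSpace

theorem norm_sub_map_sq_le {H : Type*} [NormedAddCommGroup H] [InnerProductSpace ℝ H] {R : H → H}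
    (hR : LipschitzWith 1 R) {v : H} (hv : Function.IsFixedPt R v) (x : H) :
    ‖x - R x‖ ^ 2 ≤ 2 * ⟪x - v, x - R x⟫ := by
  have hle : ‖(x - v) - (x - R x)‖ ≤ ‖x - v‖ := by
    simpa only [hv.eq, dist_eq_norm, sub_sub_sub_cancel_left, norm_sub_rev, NNReal.coe_one, one_mul]
      using hR.dist_le_mul v x
  have hsq := pow_le_pow_left₀ (norm_nonneg _) hle 2
  rw [norm_sub_sq_real] at hsq
  linarith

theorem two_mul_inner_sub_le {H : Type*} [NormedAddCommGroup H] [InnerProductSpace ℝ H] {β : ℝ}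
    (hβ : 0 < β) (z : ℕ → H) (g : H) {k m τ : ℕ} (hkm : k ≤ m) (hmk : m ≤ k + τ) :
    2 * ⟪z m - z (k + τ), g⟫
      ≤ β * ∑ i ∈ Finset.range τ, ‖z (k + i + 1) - z (k + i)‖ ^ 2 + τ * (β⁻¹ * ‖g‖ ^ 2) := by
  have hyoung : ∀ d : H, -(2 * ⟪d, g⟫) ≤ β * ‖d‖ ^ 2 + β⁻¹ * ‖g‖ ^ 2 := fun d => by
    have hsq : β * ‖d‖ ^ 2 + 2 * ⟪d, g⟫ + β⁻¹ * ‖g‖ ^ 2 = β * ‖d + β⁻¹ • g‖ ^ 2 := by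
      rw [norm_add_sq_real, real_inner_smul_right, norm_smul, Real.norm_of_nonneg (inv_pos.2 hβ).le]
      field_simp
    have hnonneg : 0 ≤ β * ‖d + β⁻¹ • g‖ ^ 2 := by positivity
    linarith
  calc 2 * ⟪z m - z (k + τ), g⟫
      = ∑ i ∈ Finset.Ico m (k + τ), -(2 * ⟪z (i + 1) - z i, g⟫) := by
        rw [Finset.sum_neg_distrib, ← Finset.mul_sum, ← sum_inner,
          Finset.sum_Ico_sub (fun i => z i) hmk, ← neg_sub (z (k + τ)), inner_neg_left, mul_neg]
    _ ≤ ∑ i ∈ Finset.Ico m (k + τ), (β * ‖z (i + 1) - z i‖ ^ 2 + β⁻¹ * ‖g‖ ^ 2) :=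
        Finset.sum_le_sum fun i _ => hyoung _
    _ ≤ ∑ i ∈ Finset.Ico k (k + τ), (β * ‖z (i + 1) - z i‖ ^ 2 + β⁻¹ * ‖g‖ ^ 2) :=
        Finset.sum_le_sum_of_subset_of_nonneg (Finset.Ico_subset_Ico_left hkm)
          fun i _ _ => by positivity
    _ = _ := by
        rw [Finset.sum_Ico_eq_sum_range, Nat.add_sub_cancel_left, Finset.sum_add_distrib,
          ← Finset.mul_sum, Finset.sum_const, Finset.card_range, nsmul_eq_mul]

variable {ι : Type*} [Fintype ι] [DecidableEq ι] {E : ι → Type*} [∀ i, NormedAddCommGroup (E i)]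
  [∀ i, InnerProductSpace ℝ (E i)] {q : ι → ℝ} {β : ℝ}

/-- A step in the coordinate `s` along `-g`. The stepsize `h / q s` makes the expected displacement
equal to `-h • g` if `s` is sampled with probability `q s`. -/
noncomputable def coordStep (q : ι → ℝ) (h : ℝ) (z g : PiLp 2 E) (s : ι) : PiLp 2 E :=
  z - PiLp.single 2 s ((h / q s) • g s)

theorem norm_coordStep_sub_self (h : ℝ) (z g : PiLp 2 E) (s : ι) :
    ‖coordStep q h z g s - z‖ = |h / q s| * ‖g s‖ := by
  rw [coordStep, sub_sub_cancel_left, norm_neg, PiLp.norm_single, norm_smul, Real.norm_eq_abs]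

theorem norm_coordStep_sub_sq (h : ℝ) (z g v : PiLp 2 E) (s : ι) :
    ‖coordStep q h z g s - v‖ ^ 2
      = ‖z - v‖ ^ 2 - 2 * (h / q s) * ⟪(z - v) s, g s⟫ + (h / q s) ^ 2 * ‖g s‖ ^ 2 := by
  have hinner : ⟪z - v, PiLp.single 2 s ((h / q s) • g s)⟫
      = h / q s * ⟪(z - v) s, g s⟫ := by
    rw [PiLp.inner_apply, Finset.sum_eq_single s, PiLp.single_eq_same, real_inner_smul_right]
    · intro i _ hi
      rw [PiLp.single_eq_of_ne 2 hi, inner_zero_right]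
    · exact fun hs => absurd (Finset.mem_univ s) hs
  rw [coordStep, sub_right_comm, norm_sub_sq_real, hinner, PiLp.norm_single, norm_smul,
    mul_pow, Real.norm_eq_abs, sq_abs, mul_assoc]

theorem sum_mul_norm_coordStep_sub_sq_le (hβ : 0 < β) (hq : ∀ s, β ^ 2 ≤ q s)
    (hq_sum : ∑ s, q s = 1) (h : ℝ) (z g v : PiLp 2 E) :
    ∑ s, q s * ‖coordStep q h z g s - v‖ ^ 2
      ≤ ‖z - v‖ ^ 2 - 2 * h * ⟪z - v, g⟫ + h ^ 2 / β ^ 2 * ‖g‖ ^ 2 := by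
  have hq0 : ∀ s, 0 < q s := fun s => lt_of_lt_of_le (by positivity) (hq s)
  calc ∑ s, q s * ‖coordStep q h z g s - v‖ ^ 2
      = ∑ s, (q s * ‖z - v‖ ^ 2 - 2 * h * ⟪(z - v) s, g s⟫ + h ^ 2 / q s * ‖g s‖ ^ 2) :=
        Finset.sum_congr rfl fun s _ => by
          rw [norm_coordStep_sub_sq]
          field_simp [(hq0 s).ne']
    _ ≤ ∑ s, (q s * ‖z - v‖ ^ 2 - 2 * h * ⟪(z - v) s, g s⟫ + h ^ 2 / β ^ 2 * ‖g s‖ ^ 2) := by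
        gcongr with s
        exact hq s
    _ = _ := by
        simp only [Finset.sum_add_distrib, Finset.sum_sub_distrib, ← Finset.mul_sum,
          ← Finset.sum_mul, hq_sum, one_mul, ← PiLp.inner_apply, ← PiLp.norm_sq_eq_of_L2]

end CoordStep

section Lyapunov

variable {H : Type*} [NormedAddCommGroup H]

/-- The Lyapunov function of the asynchronous iteration with delays at most `τ`: the squared
distance of `z (k + τ)` to `v`, corrected by the last `τ` displacements. It is indexed by the oldest
iterate that can still be read, so that no natural number subtraction occurs. -/
noncomputable def lyapunov (β : ℝ) (τ : ℕ) (v : H) (z : ℕ → H) (k : ℕ) : ℝ :=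
  ‖z (k + τ) - v‖ ^ 2
    + β * ∑ i ∈ Finset.range τ, ((i : ℝ) + 1) * ‖z (k + i + 1) - z (k + i)‖ ^ 2

variable {β : ℝ} {τ : ℕ} {v : H} {z : ℕ → H}

theorem lyapunov_nonneg (hβ : 0 ≤ β) (k : ℕ) : 0 ≤ lyapunov β τ v z k :=
  add_nonneg (sq_nonneg _) (mul_nonneg hβ (Finset.sum_nonneg fun i _ => by positivity))

theorem lyapunov_congr {z' : ℕ → H} {k : ℕ} (hz : ∀ j ≤ k + τ, z j = z' j) :
    lyapunov β τ v z k = lyapunov β τ v z' k := by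
  unfold lyapunov
  rw [hz _ le_rfl]
  congr 2
  refine Finset.sum_congr rfl fun i hi => ?_
  have hi := Finset.mem_range.1 hi
  rw [hz (k + i + 1) (by omega), hz (k + i) (by omega)]

theorem lyapunov_succ (k : ℕ) : lyapunov β τ v z (k + 1)
    = ‖z (k + τ + 1) - v‖ ^ 2 + β * τ * ‖z (k + τ + 1) - z (k + τ)‖ ^ 2
      + β * ∑ i ∈ Finset.range τ, (i : ℝ) * ‖z (k + i + 1) - z (k + i)‖ ^ 2 := by
  have hshift := Finset.sum_range_succ' (fun i : ℕ => (i : ℝ) * ‖z (k + i + 1) - z (k + i)‖ ^ 2) τ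
  rw [Finset.sum_range_succ, Nat.cast_zero, zero_mul, add_zero] at hshift
  simp only [lyapunov, add_right_comm k 1, add_assoc k _ 1, Nat.cast_add_one] at hshift ⊢
  rw [← hshift]
  ring

theorem lyapunov_eq (k : ℕ) : lyapunov β τ v z k
    = ‖z (k + τ) - v‖ ^ 2 + β * ∑ i ∈ Finset.range τ, ‖z (k + i + 1) - z (k + i)‖ ^ 2
      + β * ∑ i ∈ Finset.range τ, (i : ℝ) * ‖z (k + i + 1) - z (k + i)‖ ^ 2 := by
  simp only [lyapunov, add_mul, one_mul, Finset.sum_add_distrib]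
  ring

theorem lyapunov_update_succ (k : ℕ) (y : H) :
    lyapunov β τ v (Function.update z (k + τ + 1) y) (k + 1)
      = ‖y - v‖ ^ 2 + β * τ * ‖y - z (k + τ)‖ ^ 2
        + β * ∑ i ∈ Finset.range τ, (i : ℝ) * ‖z (k + i + 1) - z (k + i)‖ ^ 2 := by
  have hne : ∀ j ≤ k + τ, Function.update z (k + τ + 1) y j = z j := fun j hj =>
    Function.update_of_ne (by omega) _ _
  rw [lyapunov_succ, Function.update_self, hne _ le_rfl]
  congr 2
  refine Finset.sum_congr rfl fun i hi => ?_
  have hi := Finset.mem_range.1 hi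
  rw [hne (k + i + 1) (by omega), hne (k + i) (by omega)]

theorem exists_tendsto_dist_of_lyapunov {a : ℝ}
    (hΔ : Tendsto (fun k => ‖z (k + 1) - z k‖) atTop (𝓝 0))
    (ha : Tendsto (lyapunov β τ v z) atTop (𝓝 a)) :
    ∃ b, Tendsto (fun k => dist (z k) v) atTop (𝓝 b) := by
  have hlag : Tendsto (fun k => β * ∑ i ∈ Finset.range τ,
      ((i : ℝ) + 1) * ‖z (k + i + 1) - z (k + i)‖ ^ 2) atTop (𝓝 (β * ∑ i ∈ Finset.range τ,
      ((i : ℝ) + 1) * 0 ^ 2)) :=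
    (tendsto_finsetSum _ fun i _ =>
      ((hΔ.comp (tendsto_add_atTop_nat i)).pow 2).const_mul _).const_mul _
  refine ⟨√(a - β * ∑ i ∈ Finset.range τ, ((i : ℝ) + 1) * 0 ^ 2),
    (tendsto_add_atTop_iff_nat τ).1 ((ha.sub hlag).sqrt.congr fun k => ?_)⟩
  rw [lyapunov, add_sub_cancel_right, Real.sqrt_sq (norm_nonneg _), dist_eq_norm]

theorem tendsto_sub_delayed (hΔ : Tendsto (fun k => ‖z (k + 1) - z k‖) atTop (𝓝 0)) {m : ℕ → ℕ}
    (hm : ∀ k, m k ≤ k) (hdelay : ∀ k, k ≤ m k + τ) :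
    Tendsto (fun k => z k - z (m k)) atTop (𝓝 0) := by
  have hsum : Tendsto (fun k => ∑ i ∈ Finset.range τ, ‖z (k + i + 1) - z (k + i)‖) atTop (𝓝 0) := by
    rw [← Finset.sum_const_zero (s := Finset.range τ)]
    exact tendsto_finsetSum _ fun i _ => hΔ.comp (tendsto_add_atTop_nat i)
  refine (tendsto_add_atTop_iff_nat τ).1 (squeeze_zero_norm (fun k => ?_) hsum)
  calc ‖z (k + τ) - z (m (k + τ))‖
      = ‖∑ i ∈ Finset.Ico (m (k + τ)) (k + τ), (z (i + 1) - z i)‖ := by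
        rw [Finset.sum_Ico_sub (fun i => z i) (hm _)]
    _ ≤ ∑ i ∈ Finset.Ico (m (k + τ)) (k + τ), ‖z (i + 1) - z i‖ := norm_sum_le _ _
    _ ≤ ∑ i ∈ Finset.Ico k (k + τ), ‖z (i + 1) - z i‖ :=
        Finset.sum_le_sum_of_subset_of_nonneg
          (Finset.Ico_subset_Ico_left (Nat.le_of_add_le_add_right (hdelay _)))
          fun i _ _ => norm_nonneg _
    _ = ∑ i ∈ Finset.range τ, ‖z (k + i + 1) - z (k + i)‖ := by
        rw [Finset.sum_Ico_eq_sum_range, Nat.add_sub_cancel_left]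

end Lyapunov

section ExpectedDecrease

open scoped RealInnerProductSpace

variable {ι : Type*} [Fintype ι] {q : ι → ℝ} {h : ℕ → ℝ} {β c h₀ : ℝ} {τ : ℕ}

/-- The conditions on the sampling probabilities `q` (at least `β ^ 2`) and on the stepsizes `h`
under which the asynchronous iteration with delays at most `τ` converges. -/
structure AdmissibleSteps (q : ι → ℝ) (h : ℕ → ℝ) (β : ℝ) (τ : ℕ) (c h₀ : ℝ) : Prop where
  pos : 0 < β
  sq_le : ∀ s, β ^ 2 ≤ q s
  sum_eq_one : ∑ s, q s = 1
  lt_one : c < 1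
  lower_pos : 0 < h₀
  lower_le : ∀ k, h₀ ≤ h k
  mul_le : ∀ k, h k * (2 * τ * β + 1) ≤ c * β ^ 2

namespace AdmissibleSteps

theorem step_pos (hS : AdmissibleSteps q h β τ c h₀) (k : ℕ) : 0 < h k :=
  hS.lower_pos.trans_le (hS.lower_le k)

theorem sq_mul_le (hS : AdmissibleSteps q h β τ c h₀) (k : ℕ) :
    h k ^ 2 * (1 / β ^ 2 + β * τ * (1 / β ^ 2) + τ * β⁻¹) ≤ c * h k := by
  have hβ := hS.pos
  calc h k ^ 2 * (1 / β ^ 2 + β * τ * (1 / β ^ 2) + τ * β⁻¹)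
      = h k / β ^ 2 * (h k * (2 * τ * β + 1)) := by field_simp; ring
    _ ≤ h k / β ^ 2 * (c * β ^ 2) :=
      mul_le_mul_of_nonneg_left (hS.mul_le k) (div_nonneg (hS.step_pos k).le (sq_nonneg β))
    _ = c * h k := by field_simp

variable [DecidableEq ι] {E : ι → Type*} [∀ i, NormedAddCommGroup (E i)]
  [∀ i, InnerProductSpace ℝ (E i)]

theorem norm_coordStep_sub_self_le (hS : AdmissibleSteps q h β τ c h₀) (k : ℕ) (z g : PiLp 2 E)
    (s : ι) : ‖coordStep q (h k) z g s - z‖ ≤ ‖g‖ := by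
  have hβ := hS.pos
  have hk := hS.step_pos k
  have hβ2 : 0 < β ^ 2 := by positivity
  have hhq : h k ≤ q s :=
    calc h k ≤ h k * (2 * τ * β + 1) :=
          le_mul_of_one_le_right hk.le (le_add_of_nonneg_left (by positivity))
      _ ≤ c * β ^ 2 := hS.mul_le k
      _ ≤ β ^ 2 := mul_le_of_le_one_left hβ2.le hS.lt_one.le
      _ ≤ q s := hS.sq_le s
  have hq := hβ2.trans_le (hS.sq_le s)
  rw [norm_coordStep_sub_self, abs_of_pos (div_pos hk hq)]
  exact (mul_le_of_le_one_left (norm_nonneg _) ((div_le_one hq).2 hhq)).trans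
    (PiLp.norm_apply_le g s)

/-- The delay enters through `⟪z (k + τ) - v, g⟫`, while nonexpansiveness controls `⟪z m - v, g⟫`;
the displacements in the Lyapunov function pay for the difference. -/
theorem sum_mul_lyapunov_le (hS : AdmissibleSteps q h β τ c h₀) {R : PiLp 2 E → PiLp 2 E}
    (hR : LipschitzWith 1 R) {v : PiLp 2 E} (hv : Function.IsFixedPt R v) (z : ℕ → PiLp 2 E)
    {k m : ℕ} (hkm : k ≤ m) (hmk : m ≤ k + τ) :
    ∑ s, q s * lyapunov β τ v (Function.update z (k + τ + 1)
          (coordStep q (h (k + τ)) (z (k + τ)) (z m - R (z m)) s)) (k + 1)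
        + (1 - c) * h₀ * ‖z m - R (z m)‖ ^ 2
      ≤ lyapunov β τ v z k := by
  have hβ := hS.pos
  set t := h (k + τ)
  have ht : 0 < t := hS.step_pos _
  set g := z m - R (z m)
  set N := ∑ i ∈ Finset.range τ, ‖z (k + i + 1) - z (k + i)‖ ^ 2 with hN
  have hsum : ∀ x, ∑ s, q s * ‖coordStep q t (z (k + τ)) g s - x‖ ^ 2
      ≤ ‖z (k + τ) - x‖ ^ 2 - 2 * t * ⟪z (k + τ) - x, g⟫ + t ^ 2 / β ^ 2 * ‖g‖ ^ 2 :=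
    sum_mul_norm_coordStep_sub_sq_le hβ hS.sq_le hS.sum_eq_one t (z (k + τ)) g
  have hself : β * τ * ∑ s, q s * ‖coordStep q t (z (k + τ)) g s - z (k + τ)‖ ^ 2
      ≤ β * τ * (t ^ 2 / β ^ 2 * ‖g‖ ^ 2) :=
    mul_le_mul_of_nonneg_left (by simpa using hsum (z (k + τ))) (by positivity)
  have hread : t * ‖g‖ ^ 2 ≤ t * (2 * ⟪z m - v, g⟫) :=
    mul_le_mul_of_nonneg_left (norm_sub_map_sq_le hR hv (z m)) ht.le
  have hdelay : 2 * (t * ⟪z m - z (k + τ), g⟫) ≤ β * N + τ * (β⁻¹ * (t ^ 2 * ‖g‖ ^ 2)) := by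
    simpa only [real_inner_smul_right, norm_smul, mul_pow, Real.norm_eq_abs, sq_abs] using
      two_mul_inner_sub_le hβ z (t • g) hkm hmk
  have hsplit : ⟪z (k + τ) - v, g⟫ = ⟪z m - v, g⟫ - ⟪z m - z (k + τ), g⟫ := by
    rw [← inner_sub_left, sub_sub_sub_cancel_left]
  have hquad := mul_le_mul_of_nonneg_right (hS.sq_mul_le (k + τ)) (sq_nonneg ‖g‖)
  have hlower : (1 - c) * h₀ * ‖g‖ ^ 2 ≤ (1 - c) * t * ‖g‖ ^ 2 := by
    gcongr
    exacts [sub_nonneg.2 hS.lt_one.le, hS.lower_le _]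
  simp only [lyapunov_update_succ, mul_add, Finset.sum_add_distrib, mul_left_comm _ (β * τ),
    ← Finset.mul_sum, ← Finset.sum_mul, hS.sum_eq_one, one_mul]
  rw [lyapunov_eq, ← hN]
  have hv' := hsum v
  rw [hsplit] at hv'
  linear_combination hv' + hself + hread + hdelay + hquad + hlower

end AdmissibleSteps

end ExpectedDecrease

section RobbinsSiegmund

variable {Ω : Type*} {m₀ : MeasurableSpace Ω} {P : Measure Ω}

theorem eLpNorm_one_le_of_nonpos {Y : Ω → ℝ} (hY : Integrable Y P) (hneg : ∀ ω, Y ω ≤ 0) {a : ℝ}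
    (ha : a ≤ ∫ ω, Y ω ∂P) : eLpNorm Y 1 P ≤ ((-a).toNNReal : ENNReal) := by
  rw [eLpNorm_one_eq_lintegral_enorm, ← ofReal_integral_norm_eq_lintegral_enorm hY]
  refine ENNReal.ofReal_le_ofReal ?_
  simpa only [Real.norm_eq_abs, abs_of_nonpos (hneg _), integral_neg, neg_le_neg_iff] using ha

variable [IsFiniteMeasure P]

/-- The drop in `V` pays for `U`, so `-(V k + ∑ j < k, U j)` is a submartingale bounded in `L¹`. -/
theorem ae_tendsto_and_summable_of_drift {ℱ : Filtration ℕ m₀} {V U : ℕ → Ω → ℝ}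
    (hV0 : ∀ k ω, 0 ≤ V k ω) (hU0 : ∀ k ω, 0 ≤ U k ω)
    (hVm : ∀ k, StronglyMeasurable[ℱ k] (V k)) (hUm : ∀ k, StronglyMeasurable[ℱ k] (U k))
    (hVi : ∀ k, Integrable (V k) P) (hUi : ∀ k, Integrable (U k) P)
    (hdrift : ∀ k A, MeasurableSet[ℱ k] A →
      ∫ ω in A, (V (k + 1) ω + U k ω) ∂P ≤ ∫ ω in A, V k ω ∂P) :
    ∀ᵐ ω ∂P, (∃ a, Tendsto (fun k => V k ω) atTop (𝓝 a)) ∧ Summable fun k => U k ω := by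
  set Y : ℕ → Ω → ℝ := fun k ω => -(V k ω + ∑ j ∈ Finset.range k, U j ω) with hY
  have hsumi : ∀ k, Integrable (fun ω => ∑ j ∈ Finset.range k, U j ω) P := fun k =>
    integrable_finsetSum _ fun j _ => hUi j
  have hYi : ∀ k, Integrable (Y k) P := fun k => ((hVi k).add (hsumi k)).neg
  have hsub : Submartingale Y ℱ P := by
    refine submartingale_of_setIntegral_le_succ (fun k => ?_) hYi fun k A hA => ?_
    · exact ((hVm k).add (Finset.stronglyMeasurable_fun_sum _ fun j hj =>
        (hUm j).mono (ℱ.mono (Finset.mem_range.1 hj).le))).neg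
    · have hsucc : ∀ ω, V (k + 1) ω + ∑ j ∈ Finset.range (k + 1), U j ω
          = (V (k + 1) ω + U k ω) + ∑ j ∈ Finset.range k, U j ω := fun ω => by
        rw [Finset.sum_range_succ]; ring
      simp only [hY, integral_neg, neg_le_neg_iff, hsucc]
      rw [integral_add (hVi k).integrableOn (hsumi k).integrableOn,
        integral_add (f := fun ω => V (k + 1) ω + U k ω) ((hVi _).add (hUi k)).integrableOn
          (hsumi k).integrableOn]
      exact add_le_add_left (hdrift k A hA) _
  have hbdd : ∀ k, eLpNorm (Y k) 1 P ≤ ((-∫ ω, Y 0 ω ∂P).toNNReal : ENNReal) := fun k =>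
    eLpNorm_one_le_of_nonpos (hYi k)
      (fun ω => neg_nonpos.2 (add_nonneg (hV0 k ω) (Finset.sum_nonneg fun j _ => hU0 j ω)))
      (by simpa using hsub.setIntegral_le (Nat.zero_le k) MeasurableSet.univ)
  filter_upwards [hsub.exists_ae_tendsto_of_bdd hbdd] with ω ⟨a, ha⟩
  have hsum : Summable fun k => U k ω := by
    obtain ⟨b, hb⟩ := ha.bddBelow_range
    refine summable_of_sum_range_le (c := -b) (fun k => hU0 k ω) fun k => ?_
    have hbk : b ≤ Y k ω := hb ⟨k, rfl⟩
    linarith [hV0 k ω]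
  refine ⟨⟨-a - ∑' k, U k ω, (ha.neg.sub hsum.hasSum.tendsto_sum_nat).congr fun k => ?_⟩, hsum⟩
  simp only [hY, neg_neg, add_sub_cancel_right]

end RobbinsSiegmund

section FiniteFactor

variable {Ω κ σ : Type*} [Finite κ] [MeasurableSpace κ] [MeasurableSingletonClass κ] {H : Ω → κ}

theorem measurable_comap_of_factorsThrough {X : Type*} [MeasurableSpace X] {f : Ω → X}
    (hf : f.FactorsThrough H) : Measurable[MeasurableSpace.comap H inferInstance] f := by
  refine fun B _ => ⟨H '' (f ⁻¹' B), (Set.toFinite _).measurableSet, Set.ext fun ω => ?_⟩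
  refine ⟨fun ⟨ω', hω', heq⟩ => ?_, fun hω => ⟨ω, hω, rfl⟩⟩
  rwa [Set.mem_preimage, ← hf heq]

variable [MeasurableSpace Ω] {P : Measure Ω} [IsFiniteMeasure P]

theorem integrable_comp_of_finite (hH : Measurable H) (Φ : κ → ℝ) :
    Integrable (fun ω => Φ (H ω)) P :=
  (Integrable.of_finite (μ := P.map H)).comp_measurable hH

theorem integral_comp_of_fintype {κ : Type*} [Fintype κ] [MeasurableSpace κ]
    [MeasurableSingletonClass κ] {H : Ω → κ} (hH : Measurable H) (Φ : κ → ℝ) :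
    ∫ ω, Φ (H ω) ∂P = ∑ a, P.real (H ⁻¹' {a}) * Φ a := by
  rw [← integral_map hH.aemeasurable Integrable.of_finite.aestronglyMeasurable,
    integral_fintype Integrable.of_finite]
  refine Finset.sum_congr rfl fun a _ => ?_
  rw [map_measureReal_apply hH (measurableSet_singleton a), smul_eq_mul]

variable [Fintype σ] [MeasurableSpace σ] [MeasurableSingletonClass σ] {u : Ω → σ} {q : σ → ℝ}

theorem integral_le_of_conditional_law (hH : Measurable H) (hu : Measurable u)
    (hlaw : ∀ᵐ ω ∂P, ∀ s, P.real (H ⁻¹' {H ω} ∩ u ⁻¹' {s}) = q s * P.real (H ⁻¹' {H ω}))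
    {F : κ → σ → ℝ} {G : κ → ℝ} (hle : ∀ᵐ ω ∂P, ∑ s, q s * F (H ω) s ≤ G (H ω)) :
    ∫ ω, F (H ω) (u ω) ∂P ≤ ∫ ω, G (H ω) ∂P := by
  have := Fintype.ofFinite κ
  rw [integral_comp_of_fintype (hH.prodMk hu) fun a => F a.1 a.2, integral_comp_of_fintype hH,
    Fintype.sum_prod_type]
  refine Finset.sum_le_sum fun a _ => ?_
  have hpre : ∀ s, (fun ω => (H ω, u ω)) ⁻¹' {(a, s)} = H ⁻¹' {a} ∩ u ⁻¹' {s} := fun s => by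
    ext ω; simp only [Set.mem_preimage, Set.mem_singleton_iff, Prod.mk.injEq, Set.mem_inter_iff]
  simp only [hpre]
  by_cases hzero : P (H ⁻¹' {a}) = 0
  · simp only [measureReal_def, hzero, measure_mono_null Set.inter_subset_left hzero,
      ENNReal.toReal_zero, zero_mul, Finset.sum_const_zero, le_refl]
  · obtain ⟨ω, rfl, hlawω, hleω⟩ :=
      ((frequently_ae_mem_iff.2 hzero).and_eventually (hlaw.and hle)).exists
    simp only [hlawω, mul_assoc, mul_left_comm (q _), ← Finset.mul_sum]
    exact mul_le_mul_of_nonneg_left hleω measureReal_nonneg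

theorem setIntegral_le_of_conditional_law (hH : Measurable H) (hu : Measurable u)
    (hlaw : ∀ᵐ ω ∂P, ∀ s, P.real (H ⁻¹' {H ω} ∩ u ⁻¹' {s}) = q s * P.real (H ⁻¹' {H ω}))
    {F : κ → σ → ℝ} {G : κ → ℝ} (hle : ∀ᵐ ω ∂P, ∑ s, q s * F (H ω) s ≤ G (H ω)) (B : Set κ) :
    ∫ ω in H ⁻¹' B, F (H ω) (u ω) ∂P ≤ ∫ ω in H ⁻¹' B, G (H ω) ∂P := by
  classical
  have hB : MeasurableSet (H ⁻¹' B) := hH (Set.toFinite B).measurableSet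
  rw [← integral_indicator hB, ← integral_indicator hB]
  refine integral_le_of_conditional_law (F := fun a s => B.indicator (F · s) a)
    (G := B.indicator G) hH hu hlaw ?_
  filter_upwards [hle] with ω hω
  by_cases hmem : H ω ∈ B
  · simpa only [Set.indicator_of_mem hmem] using hω
  · simp only [Set.indicator_of_notMem hmem, mul_zero, Finset.sum_const_zero, le_refl]

end FiniteFactor

section FiniteHistory

variable {Ω σ : Type*} [MeasurableSpace Ω] {κ : ℕ → Type*} [∀ k, Finite (κ k)]
  [∀ k, MeasurableSpace (κ k)] [∀ k, MeasurableSingletonClass (κ k)] {H : ∀ k, Ω → κ k}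

/-- The filtration generated by a sequence of finitely valued observations, each of which determines
the preceding one. -/
def finiteFiltration (hH : ∀ k, Measurable (H k)) (hmono : ∀ k, (H k).FactorsThrough (H (k + 1))) :
    Filtration ℕ ‹MeasurableSpace Ω› where
  seq k := MeasurableSpace.comap (H k) inferInstance
  mono' := monotone_nat_of_le_succ fun k =>
    (measurable_comap_of_factorsThrough (hmono k)).comap_le
  le' k := (hH k).comap_le

variable [Fintype σ] [MeasurableSpace σ] [MeasurableSingletonClass σ] {u : ℕ → Ω → σ} {q : σ → ℝ}
  {P : Measure Ω} [IsFiniteMeasure P]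

theorem ae_tendsto_and_summable_of_conditional_law (hH : ∀ k, Measurable (H k))
    (hmono : ∀ k, (H k).FactorsThrough (H (k + 1))) (hu : ∀ k, Measurable (u k))
    (hlaw : ∀ᵐ ω ∂P, ∀ k s,
      P.real (H k ⁻¹' {H k ω} ∩ u k ⁻¹' {s}) = q s * P.real (H k ⁻¹' {H k ω}))
    {V U : ℕ → Ω → ℝ} {F : ℕ → Ω → σ → ℝ} (hV0 : ∀ k ω, 0 ≤ V k ω) (hU0 : ∀ k ω, 0 ≤ U k ω)
    (hV : ∀ k, (V k).FactorsThrough (H k)) (hU : ∀ k, (U k).FactorsThrough (H k))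
    (hF : ∀ k, (F k).FactorsThrough (H k)) (hsucc : ∀ k ω, V (k + 1) ω = F k ω (u k ω))
    (hdrift : ∀ᵐ ω ∂P, ∀ k, ∑ s, q s * F k ω s + U k ω ≤ V k ω) :
    ∀ᵐ ω ∂P, (∃ a, Tendsto (fun k => V k ω) atTop (𝓝 a)) ∧ Summable fun k => U k ω := by
  choose V' hV' using fun k => (Function.factorsThrough_iff _).1 (hV k)
  choose U' hU' using fun k => (Function.factorsThrough_iff _).1 (hU k)
  choose F' hF' using fun k => (Function.factorsThrough_iff _).1 (hF k)
  have hVi : ∀ k, Integrable (V k) P := fun k => hV' k ▸ integrable_comp_of_finite (hH k) (V' k)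
  have hUi : ∀ k, Integrable (U k) P := fun k => hU' k ▸ integrable_comp_of_finite (hH k) (U' k)
  refine ae_tendsto_and_summable_of_drift (ℱ := finiteFiltration hH hmono) hV0 hU0
    (fun k => (measurable_comap_of_factorsThrough (hV k)).stronglyMeasurable)
    (fun k => (measurable_comap_of_factorsThrough (hU k)).stronglyMeasurable) hVi hUi ?_
  rintro k _ ⟨B, -, rfl⟩
  have hle := setIntegral_le_of_conditional_law (F := F' k) (G := fun a => V' k a - U' k a) (hH k)
    (hu k) (hlaw.mono fun ω hω => hω k) (hdrift.mono fun ω hω => by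
      simpa only [hF', hV', hU', Function.comp_apply, le_sub_iff_add_le] using hω k) B
  simp only [← Function.comp_apply (f := F' k) (g := H k), ← Function.comp_apply (f := V' k),
    ← Function.comp_apply (f := U' k), ← hF', ← hV', ← hU', ← hsucc] at hle
  rwa [integral_sub (hVi k).integrableOn (hUi k).integrableOn, le_sub_iff_add_le,
    ← integral_add (hVi _).integrableOn (hUi k).integrableOn] at hle

end FiniteHistory

section Opial

variable {X : Type*} [MetricSpace X] [ProperSpace X]

theorem exists_tendsto_of_tendsto_dist {z : ℕ → X} {F D : Set X} (hD : D.Nonempty)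
    (hF : ∀ x, MapClusterPt x atTop z → x ∈ F) (hdense : F ⊆ closure D)
    (hconv : ∀ v ∈ D, ∃ b, Tendsto (fun k => dist (z k) v) atTop (𝓝 b)) :
    ∃ x ∈ F, Tendsto z atTop (𝓝 x) := by
  have hbdd : Bornology.IsBounded (Set.range z) := by
    obtain ⟨v, hv⟩ := hD
    obtain ⟨b, hb⟩ := hconv v hv
    obtain ⟨r, hr⟩ := hb.bddAbove_range
    exact Metric.isBounded_closedBall.subset (Set.range_subset_iff.2 fun k => hr ⟨k, rfl⟩ :
      Set.range z ⊆ Metric.closedBall v r)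
  obtain ⟨x, -, φ, hφ, hx⟩ := tendsto_subseq_of_bounded hbdd Set.mem_range_self
  have hxF : x ∈ F := hF x (hx.mapClusterPt.of_comp hφ.tendsto_atTop)
  refine ⟨x, hxF, Metric.tendsto_atTop'.2 fun ε hε => ?_⟩
  obtain ⟨y, hyD, hxy⟩ := Metric.mem_closure_iff.1 (hdense hxF) (ε / 2) (half_pos hε)
  obtain ⟨b, hb⟩ := hconv y hyD
  have hby : b = dist x y :=
    tendsto_nhds_unique (hb.comp hφ.tendsto_atTop) (hx.dist tendsto_const_nhds)
  obtain ⟨N, hN⟩ := eventually_atTop.1 (hb.eventually_lt_const (hby.trans_lt hxy))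
  refine ⟨N, fun k hk => ?_⟩
  calc dist (z k) x ≤ dist (z k) y + dist x y := dist_triangle_right _ _ _
    _ < ε := by linarith [hN k hk.le]

end Opial

section MeasurableLimit

variable {Ω X : Type*} [MeasurableSpace Ω] {P : Measure Ω} [TopologicalSpace X]
  [TopologicalSpace.MetrizableSpace X] [MeasurableSpace X] [BorelSpace X]

theorem exists_measurable_limit_of_ae_exists_tendsto {f : ℕ → Ω → X} {F : Set X}
    (hf : ∀ k, Measurable (f k)) (hlim : ∀ᵐ ω ∂P, ∃ x ∈ F, Tendsto (f · ω) atTop (𝓝 x)) :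
    ∃ g : Ω → X, Measurable g ∧ (∀ᵐ ω ∂P, g ω ∈ F) ∧
      ∀ᵐ ω ∂P, Tendsto (f · ω) atTop (𝓝 (g ω)) := by
  obtain ⟨g, hg, hfg⟩ := measurable_limit_of_tendsto_metrizable_ae
    (fun k => (hf k).aemeasurable) (hlim.mono fun ω ⟨x, _, hx⟩ => ⟨x, hx⟩)
  refine ⟨g, hg, ?_, hfg⟩
  filter_upwards [hlim, hfg] with ω ⟨x, hxF, hx⟩ hgω
  exact tendsto_nhds_unique hx hgω ▸ hxF

end MeasurableLimit

section AsyncIteration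

variable {Ω : Type*} {S M : ℕ}

/-- The workers that return at the updates `0, …, k` and the scenarios incorporated at the updates
`0, …, k - 1`: the information on which the scenario incorporated at update `k` is conditioned. -/
def history (w : ℕ → Ω → Fin M) (u : ℕ → Ω → Fin S) (k : ℕ) (ω : Ω) :
    (Fin (k + 1) → Fin M) × (Fin k → Fin S) :=
  (fun j => w j ω, fun j => u j ω)

variable {w : ℕ → Ω → Fin M} {u : ℕ → Ω → Fin S}

theorem history_eq_iff {k : ℕ} {ω ω' : Ω} : history w u k ω = history w u k ω' ↔
    (∀ j ≤ k, w j ω = w j ω') ∧ ∀ j < k, u j ω = u j ω' := by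
  simp only [history, Prod.mk.injEq, funext_iff, Fin.forall_iff, Nat.lt_succ_iff]

theorem history_factorsThrough {k l : ℕ} (hkl : k ≤ l) :
    (history w u k).FactorsThrough (history w u l) := fun ω ω' h => by
  rw [history_eq_iff] at h ⊢
  exact ⟨fun j hj => h.1 j (hj.trans hkl), fun j hj => h.2 j (hj.trans_le hkl)⟩

variable [MeasurableSpace Ω]

theorem measurable_history (hw : ∀ k, Measurable (w k)) (hu : ∀ k, Measurable (u k)) (k : ℕ) :
    Measurable (history w u k) :=
  Measurable.prodMk (f := fun ω (j : Fin (k + 1)) => w j ω) (g := fun ω (j : Fin k) => u j ω)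
    (measurable_pi_lambda _ fun j => hw j) (measurable_pi_lambda _ fun j => hu j)

theorem measurable_of_factorsThrough_history (hw : ∀ k, Measurable (w k))
    (hu : ∀ k, Measurable (u k)) {X : Type*} [MeasurableSpace X] {f : Ω → X} {k : ℕ}
    (hf : f.FactorsThrough (history w u k)) : Measurable f :=
  (measurable_comap_of_factorsThrough hf).mono (measurable_history hw hu k).comap_le le_rfl

theorem SampledFrom.measureReal_history_inter {P : Measure Ω} {q : Fin S → ℝ}
    (hs : SampledFrom P q w u) {k : ℕ} {ω : Ω} (hreturn : ∃ j < k, w j ω = w k ω) (s : Fin S) :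
    P.real (history w u k ⁻¹' {history w u k ω} ∩ u k ⁻¹' {s})
      = q s * P.real (history w u k ⁻¹' {history w u k ω}) := by
  have hatom : history w u k ⁻¹' {history w u k ω}
      = {ω' | (∀ j ≤ k, w j ω' = w j ω) ∧ ∀ j < k, u j ω' = u j ω} :=
    Set.ext fun _ => history_eq_iff
  have hinter : {ω' | (∀ j ≤ k, w j ω' = w j ω) ∧ ∀ j < k, u j ω' = u j ω} ∩ u k ⁻¹' {s}
      = {ω' | (∀ j ≤ k, w j ω' = w j ω) ∧ (∀ j < k, u j ω' = u j ω) ∧ u k ω' = s} :=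
    Set.ext fun _ => and_assoc
  rw [hatom, hinter]
  exact hs k s (fun j => w j ω) (fun j => u j ω) hreturn

variable {E : Fin S → Type*} [∀ s, NormedAddCommGroup (E s)] [∀ s, InnerProductSpace ℝ (E s)]

/-- A randomized asynchronous coordinate iteration for the operator `R`: at update `k`, the
coordinate `u k` of `z k` moves along the residual of `R` at the outdated point `z (m k)`, which was
computed by the worker `w k`. A nonzero index `m k` signals that `w k` has returned before, so that
its scenario was drawn. -/
structure IsAsyncIteration (P : Measure Ω) (q : Fin S → ℝ) (R : PiLp 2 E → PiLp 2 E)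
    (h : ℕ → ℝ) (τ : ℕ) (w : ℕ → Ω → Fin M) (u : ℕ → Ω → Fin S) (z : ℕ → Ω → PiLp 2 E)
    (m : ℕ → Ω → ℕ) : Prop where
  measurable_worker : ∀ k, Measurable (w k)
  measurable_scen : ∀ k, Measurable (u k)
  init : ∀ ω ω', z 0 ω = z 0 ω'
  step : ∀ k ω,
    z (k + 1) ω = coordStep q (h k) (z k ω) (z (m k ω) ω - R (z (m k ω) ω)) (u k ω)
  read_le : ∀ k ω, m k ω ≤ k
  read_congr : ∀ k ω ω', (∀ j ≤ k, w j ω = w j ω') → m k ω = m k ω'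
  returned : ∀ k ω, m k ω ≠ 0 → ∃ j < k, w j ω = w k ω
  delay : ∀ᵐ ω ∂P, ∀ k, k ≤ m k ω + τ
  sampled : SampledFrom P q w u

namespace IsAsyncIteration

variable {P : Measure Ω} {q : Fin S → ℝ} {R : PiLp 2 E → PiLp 2 E} {h : ℕ → ℝ} {τ : ℕ}
  {z : ℕ → Ω → PiLp 2 E} {m : ℕ → Ω → ℕ} {β c h₀ : ℝ} {v : PiLp 2 E}

theorem factorsThrough_iterate (hA : IsAsyncIteration P q R h τ w u z m) (k : ℕ) :
    (z k).FactorsThrough (history w u k) := by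
  induction k using Nat.strong_induction_on with
  | _ k ih =>
    intro ω ω' hω
    cases k with
    | zero => exact hA.init ω ω'
    | succ k =>
      have hpast : ∀ j ≤ k, z j ω = z j ω' := fun j hj =>
        ih j (Nat.lt_succ_of_le hj) (history_factorsThrough (by omega) hω)
      rw [history_eq_iff] at hω
      rw [hA.step, hA.step, hA.read_congr k ω ω' fun j hj => hω.1 j (by omega),
        hpast k le_rfl, hpast _ (hA.read_le k ω'), hω.2 k k.lt_succ_self]

theorem iterate_eq (hA : IsAsyncIteration P q R h τ w u z m) {j k : ℕ} (hjk : j ≤ k) {ω ω' : Ω}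
    (hω : history w u k ω = history w u k ω') : z j ω = z j ω' :=
  hA.factorsThrough_iterate j (history_factorsThrough hjk hω)

theorem read_eq (hA : IsAsyncIteration P q R h τ w u z m) {k : ℕ} {ω ω' : Ω}
    (hω : history w u k ω = history w u k ω') : z (m k ω) ω = z (m k ω') ω' := by
  rw [hA.read_congr k ω ω' (history_eq_iff.1 hω).1, hA.iterate_eq (hA.read_le k ω') hω]

theorem factorsThrough_lyapunov_update (hA : IsAsyncIteration P q R h τ w u z m) (k : ℕ) :
    (fun ω s => lyapunov β τ v (Function.update (z · ω) (k + τ + 1)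
      (coordStep q (h (k + τ)) (z (k + τ) ω) (z (m (k + τ) ω) ω - R (z (m (k + τ) ω) ω)) s))
      (k + 1)).FactorsThrough (history w u (k + τ)) := fun ω ω' hω => by
  funext s
  simp only [hA.read_eq hω, hA.iterate_eq le_rfl hω]
  refine lyapunov_congr fun j hj => ?_
  rcases eq_or_ne j (k + τ + 1) with rfl | hne
  · simp only [Function.update_self]
  · simp only [Function.update_of_ne hne]
    exact hA.iterate_eq (by omega) hω

theorem ae_tendsto_lyapunov_and_residual [IsFiniteMeasure P]
    (hA : IsAsyncIteration P q R h τ w u z m)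
    (hS : AdmissibleSteps q h β τ c h₀) (hR : LipschitzWith 1 R) (hv : Function.IsFixedPt R v) :
    ∀ᵐ ω ∂P, (∃ a, Tendsto (lyapunov β τ v (z · ω)) atTop (𝓝 a)) ∧
      Tendsto (fun k => ‖z (m k ω) ω - R (z (m k ω) ω)‖) atTop (𝓝 0) := by
  have hrate : 0 < (1 - c) * h₀ := mul_pos (sub_pos.2 hS.lt_one) hS.lower_pos
  -- From update `τ + 1` on, the scenario that is incorporated was drawn.
  have hread : ∀ᵐ ω ∂P, ∀ k, k + 1 ≤ m (k + 1 + τ) ω := hA.delay.mono fun ω hω k =>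
    Nat.le_of_add_le_add_right (hω (k + 1 + τ))
  have hlaw : ∀ᵐ ω ∂P, ∀ k s, P.real (history w u (k + 1 + τ) ⁻¹' {history w u (k + 1 + τ) ω} ∩
      u (k + 1 + τ) ⁻¹' {s}) =
        q s * P.real (history w u (k + 1 + τ) ⁻¹' {history w u (k + 1 + τ) ω}) :=
    hread.mono fun ω hω k => hA.sampled.measureReal_history_inter
      (hA.returned _ ω (Nat.ne_zero_of_lt (hω k)))
  have hconv := ae_tendsto_and_summable_of_conditional_law
    (V := fun k ω => lyapunov β τ v (z · ω) (k + 1))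
    (U := fun k ω =>
      (1 - c) * h₀ * ‖z (m (k + 1 + τ) ω) ω - R (z (m (k + 1 + τ) ω) ω)‖ ^ 2)
    (fun k => measurable_history hA.measurable_worker hA.measurable_scen (k + 1 + τ))
    (fun k => history_factorsThrough (by omega)) (fun k => hA.measurable_scen (k + 1 + τ)) hlaw
    (fun k ω => lyapunov_nonneg hS.pos.le _) (fun k ω => mul_nonneg hrate.le (sq_nonneg _))
    (fun k ω ω' hω => lyapunov_congr fun j hj => hA.iterate_eq hj hω)
    (fun k ω ω' hω => by simp only [hA.read_eq hω])
    (fun k => hA.factorsThrough_lyapunov_update (k + 1))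
    (fun k ω => by rw [← hA.step, Function.update_eq_self])
    (hread.mono fun ω hω k => hS.sum_mul_lyapunov_le hR hv (z · ω) (hω k) (hA.read_le _ ω))
  filter_upwards [hconv] with ω ⟨⟨a, ha⟩, hsum⟩
  refine ⟨⟨a, (tendsto_add_atTop_iff_nat 1).1 ha⟩, ?_⟩
  have hsq := ((summable_mul_left_iff hrate.ne').1 hsum).tendsto_atTop_zero.sqrt
  simp only [Real.sqrt_sq (norm_nonneg _), Real.sqrt_zero, add_assoc] at hsq
  exact (tendsto_add_atTop_iff_nat
    (f := fun k => ‖z (m k ω) ω - R (z (m k ω) ω)‖) (1 + τ)).1 hsq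

theorem tendsto_norm_step (hA : IsAsyncIteration P q R h τ w u z m)
    (hS : AdmissibleSteps q h β τ c h₀) {ω : Ω}
    (hres : Tendsto (fun k => ‖z (m k ω) ω - R (z (m k ω) ω)‖) atTop (𝓝 0)) :
    Tendsto (fun k => ‖z (k + 1) ω - z k ω‖) atTop (𝓝 0) :=
  squeeze_zero (fun _ => norm_nonneg _)
    (fun k => hA.step k ω ▸ hS.norm_coordStep_sub_self_le k _ _ _) hres

theorem isFixedPt_of_mapClusterPt (hA : IsAsyncIteration P q R h τ w u z m)
    (hR : LipschitzWith 1 R) {ω : Ω} (hdelay : ∀ k, k ≤ m k ω + τ)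
    (hres : Tendsto (fun k => ‖z (m k ω) ω - R (z (m k ω) ω)‖) atTop (𝓝 0))
    (hstep : Tendsto (fun k => ‖z (k + 1) ω - z k ω‖) atTop (𝓝 0)) {x : PiLp 2 E}
    (hx : MapClusterPt x atTop (z · ω)) : Function.IsFixedPt R x := by
  have hread : Tendsto (fun k => z k ω - z (m k ω) ω) atTop (𝓝 0) :=
    tendsto_sub_delayed hstep (hA.read_le · ω) hdelay
  have himage : Tendsto (fun k => R (z k ω) - R (z (m k ω) ω)) atTop (𝓝 0) :=
    squeeze_zero_norm (fun k => by simpa using hR.norm_sub_le (z k ω) (z (m k ω) ω))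
      (tendsto_zero_iff_norm_tendsto_zero.1 hread)
  have hcurrent : Tendsto (fun k => z k ω - R (z k ω)) atTop (𝓝 0) := by
    have := (hread.add (tendsto_zero_iff_norm_tendsto_zero.2 hres)).sub himage
    simpa using this
  have hcluster : MapClusterPt (x - R x) atTop (fun k => z k ω - R (z k ω)) :=
    hx.continuousAt_comp (continuous_id.sub hR.continuous).continuousAt
  exact (sub_eq_zero.1 (eq_of_nhds_neBot (ClusterPt.mono hcluster hcurrent))).symm

theorem ae_exists_tendsto [IsFiniteMeasure P] [∀ s, FiniteDimensional ℝ (E s)]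
    (hA : IsAsyncIteration P q R h τ w u z m)
    (hS : AdmissibleSteps q h β τ c h₀) (hR : LipschitzWith 1 R)
    (hfix : (Function.fixedPoints R).Nonempty) :
    ∀ᵐ ω ∂P, ∃ x ∈ Function.fixedPoints R, Tendsto (z · ω) atTop (𝓝 x) := by
  have : ProperSpace (PiLp 2 E) := FiniteDimensional.proper_real _
  -- The exceptional null set depends on the fixed point; countably many of them suffice.
  obtain ⟨D, hDfix, hDcountable, hDdense⟩ :=
    (TopologicalSpace.IsSeparable.of_separableSpace
      (Function.fixedPoints R)).exists_countable_dense_subset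
  have hDne : D.Nonempty := closure_nonempty_iff.1 (hfix.mono hDdense)
  have hconv := (ae_ball_iff hDcountable).2 fun v hv =>
    hA.ae_tendsto_lyapunov_and_residual hS hR (hDfix hv)
  filter_upwards [hconv, hA.delay] with ω hω hdelay
  have hres := (hω _ hDne.some_mem).2
  have hstep := hA.tendsto_norm_step hS hres
  exact exists_tendsto_of_tendsto_dist hDne
    (fun x hx => hA.isFixedPt_of_mapClusterPt hR hdelay hres hstep hx) hDdense
    fun v hv => exists_tendsto_dist_of_lyapunov hstep (hω v hv).1.choose_spec

end IsAsyncIteration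

end AsyncIteration

section Weighting

variable {ι E : Type*} [DecidableEq ι] [NormedAddCommGroup E] [InnerProductSpace ℝ E]
  {p : ι → ℝ}

theorem coordStep_weighting (hp : ∀ i, 0 < p i) (q : ι → ℝ) (h : ℝ) (z g : ι → E) (s : ι) :
    coordStep q h (weighting p hp z) (weighting p hp g) s
      = weighting p hp (Function.update z s (z s - (h / q s) • g s)) := by
  ext i
  rw [coordStep, PiLp.sub_apply, weighting_apply, weighting_apply, weighting_apply]
  rcases eq_or_ne i s with rfl | hi
  · rw [PiLp.single_eq_same, Function.update_self, smul_sub, smul_comm]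
  · rw [PiLp.single_eq_of_ne 2 hi, Function.update_of_ne hi, sub_zero]

end Weighting

theorem admissibleSteps_of_stepsize_le {S τ : ℕ} {q : Fin S → ℝ} (hq_sum : ∑ s, q s = 1)
    {c ηmin : ℝ} (hc : 0 < c) (hc1 : c < 1) {η : ℕ → ℝ} (hηmin : 0 < ηmin)
    (hη : ∀ k, ηmin ≤ η k ∧ η k ≤ c * S * (⨅ s, q s) / (2 * τ * Real.sqrt (⨅ s, q s) + 1)) :
    AdmissibleSteps q (fun k => η k / S) (Real.sqrt (⨅ s, q s)) τ c (ηmin / S) := by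
  set qmin := ⨅ s, q s
  have hden : 0 < 2 * (τ : ℝ) * Real.sqrt qmin + 1 := by positivity
  have hnum : 0 < c * S * qmin := (div_pos_iff_of_pos_right hden).1
    (hηmin.trans_le ((hη 0).1.trans (hη 0).2))
  have hS : (0 : ℝ) < S := (Nat.cast_nonneg S).lt_of_ne' fun h => by simp [h] at hnum
  have hqmin : 0 < qmin := (mul_pos_iff_of_pos_left (mul_pos hc hS)).1 hnum
  have hsqrt : Real.sqrt qmin ^ 2 = qmin := Real.sq_sqrt hqmin.le
  refine ⟨Real.sqrt_pos.2 hqmin, fun s => ?_, hq_sum, hc1, div_pos hηmin hS,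
    fun k => div_le_div_of_nonneg_right (hη k).1 hS.le, fun k => ?_⟩
  · exact hsqrt.trans_le (ciInf_le (Set.finite_range q).bddBelow s)
  · rw [hsqrt, div_mul_eq_mul_div, div_le_iff₀ hS, mul_right_comm c]
    exact (le_div_iff₀ hden).1 (hη k).2

namespace Problem

section Run

variable {S T M : ℕ} {n : Fin T → ℕ} {Ξ : Fin (T - 1) → Type*} {D : Problem S T n Ξ}
  {x₀ : Decision S n} {s₀ : Fin M → Fin S} {q : Fin S → ℝ} {μ : ℝ} {η : ℕ → ℝ}

theorem start_run_le (w : ℕ → Fin M) (draw : ℕ → Fin S) (k : ℕ) (j : Fin M) :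
    (D.run x₀ s₀ q μ η w draw k).start j ≤ k := by
  induction k with
  | zero => exact le_rfl
  | succ k ih =>
    simp only [run, step, Function.update_apply]
    split_ifs
    exacts [le_rfl, ih.trans k.le_succ]

theorem exists_lt_of_start_run_ne_zero {w : ℕ → Fin M} {draw : ℕ → Fin S} {k : ℕ} {j : Fin M}
    (h : (D.run x₀ s₀ q μ η w draw k).start j ≠ 0) : ∃ i < k, w i = j := by
  induction k with
  | zero => exact absurd rfl h
  | succ k ih =>
    rcases eq_or_ne j (w k) with rfl | hj
    · exact ⟨k, k.lt_succ_self, rfl⟩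
    · simp only [run, step, Function.update_of_ne hj] at h
      obtain ⟨i, hi, hwi⟩ := ih h
      exact ⟨i, hi.trans k.lt_succ_self, hwi⟩

theorem start_run_congr {w w' : ℕ → Fin M} {draw draw' : ℕ → Fin S} {k : ℕ}
    (hw : ∀ j < k, w j = w' j) :
    (D.run x₀ s₀ q μ η w draw k).start = (D.run x₀ s₀ q μ η w' draw' k).start := by
  induction k with
  | zero => rfl
  | succ k ih =>
    simp only [run, step]
    rw [ih fun j hj => hw j (by omega), hw k k.lt_succ_self]

theorem run_congr {w w' : ℕ → Fin M} {draw draw' : ℕ → Fin S} {k : ℕ}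
    (hw : ∀ j < k, w j = w' j) (hdraw : ∀ j < k, draw j = draw' j) :
    D.run x₀ s₀ q μ η w draw k = D.run x₀ s₀ q μ η w' draw' k := by
  induction k with
  | zero => rfl
  | succ k ih =>
    simp only [run]
    rw [ih (fun j hj => hw j (by omega)) fun j hj => hdraw j (by omega), hw k k.lt_succ_self,
      hdraw k k.lt_succ_self]

theorem measurable_usedScen {Ω : Type*} [MeasurableSpace Ω] {w : ℕ → Ω → Fin M}
    {draw : ℕ → Ω → Fin S} (hw : ∀ k, Measurable (w k)) (hdraw : ∀ k, Measurable (draw k)) (k : ℕ) :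
    Measurable fun ω => D.usedScen x₀ s₀ q μ η (w · ω) (draw · ω) k := by
  refine measurable_of_factorsThrough_history hw hdraw (k := k) fun ω ω' h => ?_
  rw [history_eq_iff] at h
  simp only [usedScen]
  rw [run_congr (fun j hj => h.1 j hj.le) h.2, h.1 k le_rfl]

theorem measurable_output {Ω : Type*} [MeasurableSpace Ω] {w : ℕ → Ω → Fin M}
    {draw : ℕ → Ω → Fin S} (hw : ∀ k, Measurable (w k)) (hdraw : ∀ k, Measurable (draw k)) (k : ℕ) :
    Measurable fun ω => D.output x₀ s₀ q μ η (w · ω) (draw · ω) k := by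
  refine measurable_of_factorsThrough_history hw hdraw (k := k) fun ω ω' h => ?_
  rw [history_eq_iff] at h
  simp only [output]
  rw [run_congr (fun j hj => h.1 j hj.le) h.2]

theorem Assumptions.old_sent_run_eq (hD : D.Assumptions) (hx₀ : x₀ ∈ D.nonant) (w : ℕ → Fin M)
    (draw : ℕ → Fin S) (k : ℕ) (j : Fin M) :
    let σ := D.run x₀ s₀ q μ η w draw k
    let z := (D.run x₀ s₀ q μ η w draw (σ.start j)).z
    σ.old j = D.proj z (σ.scen j) ∧ σ.sent j = (2 : ℝ) • D.proj z (σ.scen j) - z (σ.scen j) := by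
  induction k with
  | zero =>
    change x₀ (s₀ j) = D.proj x₀ (s₀ j) ∧ x₀ (s₀ j) = (2 : ℝ) • D.proj x₀ (s₀ j) - x₀ (s₀ j)
    rw [hD.proj_eq_self hx₀, two_smul, add_sub_cancel_right]
    exact ⟨rfl, rfl⟩
  | succ k ih =>
    intro σ z
    rcases eq_or_ne j (w k) with rfl | hj
    · have hstart : σ.start (w k) = k + 1 := Function.update_self _ _ _
      have hscen : σ.scen (w k) = draw k := Function.update_self _ _ _
      simp only [z, hstart, hscen]
      exact ⟨Function.update_self _ _ _, Function.update_self _ _ _⟩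
    · have hstart : σ.start j = (D.run x₀ s₀ q μ η w draw k).start j := Function.update_of_ne hj _ _
      have hscen : σ.scen j = (D.run x₀ s₀ q μ η w draw k).scen j := Function.update_of_ne hj _ _
      simp only [z, hstart, hscen]
      exact ⟨(Function.update_of_ne hj _ _).trans ih.1, (Function.update_of_ne hj _ _).trans ih.2⟩

theorem Assumptions.weighting_run_succ (hD : D.Assumptions) (hx₀ : x₀ ∈ D.nonant) (w : ℕ → Fin M)
    (draw : ℕ → Fin S) (k : ℕ) :
    let σ := D.run x₀ s₀ q μ η w draw
    let zread := weighting D.p hD.p_pos (σ ((σ k).start (w k))).z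
    weighting D.p hD.p_pos (σ (k + 1)).z
      = coordStep q (η k / S) (weighting D.p hD.p_pos (σ k).z) (zread - hD.drOperator μ zread)
        (D.usedScen x₀ s₀ q μ η w draw k) := by
  intro σ zread
  obtain ⟨hold, hsent⟩ := hD.old_sent_run_eq (s₀ := s₀) (q := q) (μ := μ) (η := η) hx₀ w draw k
    (w k)
  rw [hD.drOperator_weighting, ← map_sub, coordStep_weighting]
  congr 1
  change Function.update (σ k).z (D.usedScen x₀ s₀ q μ η w draw k) _ = _
  congr 1
  rw [hold, hsent, Pi.sub_apply, drReflection, proxReflection]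
  simp only [σ, usedScen]
  module

theorem Assumptions.isAsyncIteration_run (hD : D.Assumptions) (hx₀ : x₀ ∈ D.nonant) {τ : ℕ}
    {Ω : Type*} [MeasurableSpace Ω] {P : Measure Ω} {w : ℕ → Ω → Fin M}
    (hw : ∀ k, Measurable (w k)) {draw : ℕ → Ω → Fin S} (hdraw : ∀ k, Measurable (draw k))
    (hsample : SampledFrom P q w (fun k ω => D.usedScen x₀ s₀ q μ η (w · ω) (draw · ω) k))
    (hdelay : ∀ᵐ ω ∂P, ∀ k, D.delay x₀ s₀ q μ η (w · ω) (draw · ω) k ≤ τ) :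
    IsAsyncIteration P q (hD.drOperator μ) (fun k => η k / S) τ w
      (fun k ω => D.usedScen x₀ s₀ q μ η (w · ω) (draw · ω) k)
      (fun k ω => weighting D.p hD.p_pos (D.run x₀ s₀ q μ η (w · ω) (draw · ω) k).z)
      (fun k ω => (D.run x₀ s₀ q μ η (w · ω) (draw · ω) k).start (w k ω)) where
  measurable_worker := hw
  measurable_scen := measurable_usedScen hw hdraw
  init _ _ := rfl
  step k ω := hD.weighting_run_succ hx₀ (w · ω) (draw · ω) k
  read_le k ω := start_run_le (w · ω) (draw · ω) k (w k ω)
  read_congr k ω ω' h := by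
    rw [start_run_congr (draw' := (draw · ω')) fun j hj => h j hj.le, h k le_rfl]
  returned k ω h := exists_lt_of_start_run_ne_zero h
  delay := hdelay.mono fun ω hω k => by simpa [delay, add_comm] using hω k
  sampled := hsample

theorem Assumptions.nonempty_fixedPoints_drOperator (hD : D.Assumptions) (hμ : 0 < μ) :
    (Function.fixedPoints (hD.drOperator μ)).Nonempty := by
  obtain ⟨x, u, hkkt⟩ := hD.exists_isKKTPair
  refine ⟨weighting D.p hD.p_pos (x - μ • u), ?_⟩
  rw [Function.mem_fixedPoints_iff, hD.drOperator_weighting, hkkt.drReflection_eq hD hμ]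

theorem Assumptions.proj_mem_solutions_of_isFixedPt (hD : D.Assumptions) (hμ : 0 < μ)
    {z : PiLp 2 fun _ : Fin S => Row n} (hz : Function.IsFixedPt (hD.drOperator μ) z) :
    D.proj ((weighting D.p hD.p_pos).symm z) ∈ D.solutions := by
  refine IsKKTPair.mem_solutions hD (isKKTPair_of_drReflection_eq hD hμ ?_)
  apply (weighting D.p hD.p_pos).injective
  rw [ContinuousLinearEquiv.apply_symm_apply]
  exact hz

end Run

end Problem

end ProgHedging

theorem theorem3 {S T M : ℕ} {n : Fin T → ℕ} {Ξ : Fin (T - 1) → Type*}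
    (D : ProgHedging.Problem S T n Ξ) (hD : D.Assumptions)
    -- sampling probabilities, proximal parameter, initialization
    (q : Fin S → ℝ) (hq : ∀ s, 0 ≤ q s) (hq_sum : ∑ s, q s = 1)
    (μ : ℝ) (hμ : 0 < μ)
    (x₀ : ProgHedging.Decision S n) (hx₀ : x₀ ∈ D.nonant) (s₀ : Fin M → Fin S)
    -- stepsizes
    (τ : ℕ) (c ηmin : ℝ) (hc : 0 < c) (hc1 : c < 1) (η : ℕ → ℝ) (hηmin : 0 < ηmin)
    (hη : ∀ k, ηmin ≤ η k ∧
      η k ≤ c * S * (⨅ s, q s) / (2 * τ * Real.sqrt (⨅ s, q s) + 1))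
    -- returning workers and drawn scenarios
    {Ω : Type*} [MeasurableSpace Ω] (P : Measure Ω) [IsProbabilityMeasure P]
    (w : ℕ → Ω → Fin M) (hw : ∀ k, Measurable (w k))
    (draw : ℕ → Ω → Fin S) (hdraw : ∀ k, Measurable (draw k))
    (hsample : ProgHedging.SampledFrom P q w
      (fun k ω => D.usedScen x₀ s₀ q μ η (fun j => w j ω) (fun j => draw j ω) k))
    -- bounded delays
    (hdelay : ∀ᵐ ω ∂P, ∀ k,
      D.delay x₀ s₀ q μ η (fun j => w j ω) (fun j => draw j ω) k ≤ τ) :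
    (∀ᵐ ω ∂P, ∀ k,
      D.output x₀ s₀ q μ η (fun j => w j ω) (fun j => draw j ω) k ∈ D.nonant) ∧
    ∃ X : Ω → ProgHedging.Decision S n, Measurable X ∧
      (∀ᵐ ω ∂P, X ω ∈ D.solutions) ∧
      ∀ᵐ ω ∂P, Tendsto
        (fun k => D.output x₀ s₀ q μ η (fun j => w j ω) (fun j => draw j ω) k)
        atTop (𝓝 (X ω)) := by
  refine ⟨Eventually.of_forall fun ω k => D.proj_mem _,
    ProgHedging.exists_measurable_limit_of_ae_exists_tendsto
      (ProgHedging.Problem.measurable_output hw hdraw) ?_⟩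
  have hsteps := ProgHedging.admissibleSteps_of_stepsize_le hq_sum hc hc1 hηmin hη
  have hiter := hD.isAsyncIteration_run hx₀ hw hdraw hsample hdelay
  filter_upwards [hiter.ae_exists_tendsto hsteps (hD.lipschitzWith_drOperator hμ)
    (hD.nonempty_fixedPoints_drOperator hμ)] with ω ⟨z, hz, hlim⟩
  refine ⟨_, hD.proj_mem_solutions_of_isFixedPt hμ hz, ?_⟩
  simpa only [ProgHedging.Problem.output, Function.comp_def,
    ContinuousLinearEquiv.symm_apply_apply] using
    ((D.continuous_proj.comp (ProgHedging.weighting D.p hD.p_pos).symm.continuous).tendsto z).comp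
      hlim
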